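/- Let $n\ge 1$ and let $\mu_0^n=(V,\cdot)$ be the complex algebra with basis $e_1,\dots,e_n$ and products $e_i\cdot e_j=e_{i+j}$ if $i+j\le n$, and $e_i\cdot e_j=0$ otherwise. An associative bilinear product $\star$ on $V$ gives a $(12)$-matching structure $(\mu_0^n,\cdot,\star)$ if $(a\cdot b)\star c=a\star(b\cdot c)$ and $(a\star b)\cdot c=a\cdot(b\star c)$ for all $a,b,c\in V$; the products $\cdot,\star$ are id-matching if $(a\cdot b)\star c=a\cdot(b\star c)$ and $(a\star b)\cdot c=a\star(b\cdot c)$ for all $a,b,c$. An isomorphism is a linear bijection that respects both products. For $3\le s\le n-1$, $\alpha\in\mathbb C$ and $\beta_1,\dots,\beta_{n-1}\in\mathbb C$ let $(12)_s(\alpha,\beta_1,\dots,\beta_{n-1})$ be the algebra with first product $\cdot$ and $$e_i\star e_j=[i+j\le n-1]\,\alpha e_{i+j}+[i+j\le n-s+1]\,e_{s+i+j-2}+\beta_{i+j-1}e_n\quad(2\le i+j\le n),$$ where $[P]$ is $1$ if $P$ holds and $0$ otherwise, and $e_i\star e_j=0$ for $i+j>n$. Consider the following families, all with first product $\cdot$,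 with complex parameters, and with omitted products equal to $0$. * $\mathbb A_1(\beta_2,\dots,\beta_{n-1})$: $e_1\star e_1=e_1$, and $e_i\star e_j=e_{i+j-1}+\beta_{i+j-1}e_n$ for $3\le i+j\le n$. * $\mathbb A_2(\alpha,\beta)$, $n\ge 3$, $\beta\ne\alpha$: $e_i\star e_j=\alpha e_{i+j}$ for $i+j\le n-1$, and $e_i\star e_j=\beta e_n$ for $i+j=n$. * $\mathbb A_{3,r}(\alpha)$, $2\le r\le n-1$: $e_i\star e_j=\alpha e_{i+j}$ for $i+j\le n$, $i+j\ne n-r+1$, and $e_i\star e_j=\alpha e_{n-r+1}+e_n$ for $i+j=n-r+1$. * $\mathbb A_{4,s}(\alpha,\beta_s,\dots,\beta_{n-1})$, $3\le s\le n-1$, $\beta_{n-1}\neq\alpha$: the algebra $(12)_s$ with $\beta_i=0$ for $i<s$. * $\mathbb A_{5,s,r}(\alpha,\beta_{s-r+1},\dots,\beta_{n-r})$, $4\le s\le n-1$, $2\le r\le s-2$, $\beta_{n-r}\ne0$: the algebra $(12)_s$ with $\beta_{n-1}=\alpha$ and $\beta_i=0$ for $i\le s-r$ and for $n-r<i<n-1$.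 * $\mathbb A_{6,s}(\alpha,\beta_2,\dots,\beta_{n-s+1})$, $3\le s\le n-1$, $\beta_{n-s+1}\neq \frac s2$: the algebra $(12)_s$ with $\beta_{n-1}=\alpha$, $\beta_1=0$, and $\beta_i=0$ for $n-s+1<i<n-1$. * $\mathbb A_{7,s}(\alpha,\beta_1,\dots,\beta_{n-s})$, $3\le s\le n-1$: the algebra $(12)_s$ with $\beta_{n-1}=\alpha$, $\beta_{n-s+1}=\frac s2$, and $\beta_i=0$ for $n-s+1<i<n-1$. Then: 1. If $(\mu_0^n,\cdot,\star)$ is a $(12)$-matching structure, then $\cdot$ and $\star$ are id-matching or $(\mu_0^n,\cdot,\star)$ is isomorphic to one of the listed algebras; and every listed algebra is a $(12)$-matching structure on $\mu_0^n$. 2. The families are pairwise non-isomorphic: two listed algebras that belong to different families (that is, of different types $\mathbb A_1,\dots,\mathbb A_7$, or of the same type with different indices $r$ or $s$) are not isomorphic. 3. Within $\mathbb A_1$, $\mathbb A_2$ and each $\mathbb A_{3,r}$, algebras with different parameters are not isomorphic. Within each of $\mathbb A_{4,s}$, $\mathbb A_{5,s,r}$, $\mathbb A_{6,s}$, $\mathbb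 A_{7,s}$, two algebras with parameters $\alpha,(\beta_i)$ and $\alpha',(\beta_i')$ are isomorphic if and only if $\alpha'=\alpha$ and there is $\zeta\in\mathbb C$ with $\zeta^{s-2}=1$ such that $\beta_i'=\zeta^{\,n-1-i}\beta_i$ for every index $i$ of the parameter tuple (for $s=3$: if and only if the parameters are equal). -/

import Mathlib

noncomputable section

namespace Matching

/-- Bilinear products on a complex vector space. -/
abbrev Product (V : Type*) [AddCommGroup V] [Module ℂ V] := V →ₗ[ℂ] V →ₗ[ℂ] V

section General

variable {V W : Type*} [AddCommGroup V] [Module ℂ V] [AddCommGroup W] [Module ℂ W]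

/-- Associativity of a product. -/
def IsAssoc (m : Product V) : Prop := ∀ a b c : V, m (m a b) c = m a (m b c)

/-- Two associative products are `id`-matching if
`(a · b) ⋆ c = a · (b ⋆ c)` and `(a ⋆ b) · c = a ⋆ (b · c)`. -/
structure IsIdMatching (dot star : Product V) : Prop where
  dot_assoc : IsAssoc dot
  star_assoc : IsAssoc star
  dot_star : ∀ a b c : V, star (dot a b) c = dot a (star b c)
  star_dot : ∀ a b c : V, dot (star a b) c = star a (dot b c)

/-- Two associative products are `(12)`-matching if
`(a · b) ⋆ c = a ⋆ (b · c)` and `(a ⋆ b) · c = a · (b ⋆ c)`. -/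
structure Is12Matching (dot star : Product V) : Prop where
  dot_assoc : IsAssoc dot
  star_assoc : IsAssoc star
  star_inner : ∀ a b c : V, star (dot a b) c = star a (dot b c)
  dot_inner : ∀ a b c : V, dot (star a b) c = dot a (star b c)

/-- Isomorphism of algebras with two products: one linear bijection respecting both products. -/
def Isomorphic (dot star : Product V) (dot' star' : Product W) : Prop :=
  ∃ φ : V ≃ₗ[ℂ] W, (∀ a b : V, φ (dot a b) = dot' (φ a) (φ b)) ∧
    (∀ a b : V, φ (star a b) = star' (φ a) (φ b))

end General

/-- The basis vector `e_k` of `ℂⁿ`, where `1 ≤ k ≤ n` (the coordinate with index `i : Fin n`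
belongs to `e_{i+1}`). For all other `k` the value is `0`. -/
def e (n k : ℕ) : Fin n → ℂ := fun i => if (i : ℕ) + 1 = k then 1 else 0

/-- The bilinear product on `ℂⁿ` with `e_i * e_j = f (i + j)` for `1 ≤ i, j ≤ n`. -/
def ofSum (n : ℕ) (f : ℕ → Fin n → ℂ) : Product (Fin n → ℂ) :=
  LinearMap.mk₂ ℂ
    (fun x y => ∑ i : Fin n, ∑ j : Fin n, (x i * y j) • f (((i : ℕ) + 1) + ((j : ℕ) + 1)))
    (by intro x x' y; simp [add_mul, add_smul, Finset.sum_add_distrib])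
    (by intro c x y; simp [Finset.smul_sum, smul_smul, mul_assoc])
    (by intro x y y'; simp [mul_add, add_smul, Finset.sum_add_distrib])
    (by intro c x y; simp [Finset.smul_sum, smul_smul, mul_left_comm])

/-- The null-filiform associative algebra `μ₀ⁿ`: `e_i · e_j = e_{i+j}` if `i + j ≤ n`,
and `e_i · e_j = 0` otherwise. -/
def mu (n : ℕ) : Product (Fin n → ℂ) := ofSum n (e n)

/-- The second product of `(12)_s(α, β_1, …, β_{n-1})`, as the value at `m = i + j`:
`e_i ⋆ e_j = [m ≤ n-1] α e_m + [m ≤ n-s+1] e_{s+m-2} + β_{m-1} e_n` if `m ≤ n`,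
and `e_i ⋆ e_j = 0` if `m > n`. -/
def twelve (n s : ℕ) (α : ℂ) (β : ℕ → ℂ) (m : ℕ) : Fin n → ℂ :=
  if m ≤ n then
    (if m + 1 ≤ n then α • e n m else 0) +
    (if m + s ≤ n + 1 then e n (s + m - 2) else 0) +
    β (m - 1) • e n n
  else 0

/-- Names of the algebras in the classification. A sequence argument `β` stands for a finite
tuple: only the entries in the following index ranges are used.
`A1`: `2 ≤ i ≤ n-1`; `A4`: `s ≤ i ≤ n-1`; `A5`: `s-r+1 ≤ i ≤ n-r`; `A6`: `2 ≤ i ≤ n-s+1`;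
`A7`: `1 ≤ i ≤ n-s`. -/
inductive Label : Type
  | A1 (β : ℕ → ℂ)
  | A2 (α β : ℂ)
  | A3 (r : ℕ) (α : ℂ)
  | A4 (s : ℕ) (α : ℂ) (β : ℕ → ℂ)
  | A5 (s r : ℕ) (α : ℂ) (β : ℕ → ℂ)
  | A6 (s : ℕ) (α : ℂ) (β : ℕ → ℂ)
  | A7 (s : ℕ) (α : ℂ) (β : ℕ → ℂ)

/-- Names of the families; the continuous parameters are forgotten. -/
inductive Family : Type
  | F1
  | F2
  | F3 (r : ℕ)
  | F4 (s : ℕ)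
  | F5 (s r : ℕ)
  | F6 (s : ℕ)
  | F7 (s : ℕ)

namespace Label

/-- The family to which an algebra of the list belongs. -/
def family : Label → Family
  | A1 _ => .F1
  | A2 _ _ => .F2
  | A3 r _ => .F3 r
  | A4 s _ _ => .F4 s
  | A5 s r _ _ => .F5 s r
  | A6 s _ _ => .F6 s
  | A7 s _ _ => .F7 s

/-- The parameter ranges in dimension `n`. -/
def Valid (n : ℕ) : Label → Prop
  | A1 _ => True
  | A2 α β => 3 ≤ n ∧ β ≠ α
  | A3 r _ => 2 ≤ r ∧ r ≤ n - 1
  | A4 s α β => 3 ≤ s ∧ s ≤ n - 1 ∧ β (n - 1) ≠ α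
  | A5 s r _ β => 4 ≤ s ∧ s ≤ n - 1 ∧ 2 ≤ r ∧ r ≤ s - 2 ∧ β (n - r) ≠ 0
  | A6 s _ β => 3 ≤ s ∧ s ≤ n - 1 ∧ β (n - s + 1) ≠ (s : ℂ) / 2
  | A7 s _ _ => 3 ≤ s ∧ s ≤ n - 1

/-- The value of `e_i ⋆ e_j` at `m = i + j ≥ 2` for the algebras of the list. -/
def value (n : ℕ) : Label → ℕ → Fin n → ℂ
  | A1 β => fun m =>
      if m = 2 then e n 1
      else if m ≤ n then e n (m - 1) + β (m - 1) • e n n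
      else 0
  | A2 α β => fun m =>
      if m + 1 ≤ n then α • e n m
      else if m = n then β • e n n
      else 0
  | A3 r α => fun m =>
      if m + r = n + 1 then α • e n m + e n n
      else if m ≤ n then α • e n m
      else 0
  | A4 s α β => twelve n s α (fun i => if s ≤ i then β i else 0)
  | A5 s r α β => twelve n s α (fun i =>
      if i = n - 1 then α
      else if s - r + 1 ≤ i ∧ i ≤ n - r then β i
      else 0)
  | A6 s α β => twelve n s α (fun i =>
      if i = n - 1 then α
      else if 2 ≤ i ∧ i ≤ n - s + 1 then β i
      else 0)
  | A7 s α β => twelve n s α (fun i =>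
      if i = n - 1 then α
      else if i = n - s + 1 then (s : ℂ) / 2
      else if 1 ≤ i ∧ i ≤ n - s then β i
      else 0)

/-- The second product of an algebra of the list; the first product is always `mu n`. -/
def star (n : ℕ) (L : Label) : Product (Fin n → ℂ) := ofSum n (L.value n)

/-- The tuples `(β_a, …, β_b)` and `(β'_a, …, β'_b)` agree up to an `(s-2)`-th root of unity `ζ`,
which acts on the entry with index `i` with weight `n - 1 - i`. For `s = 3` this is equality. -/
def RootRelated (n s a b : ℕ) (β β' : ℕ → ℂ) : Prop :=
  ∃ ζ : ℂ, ζ ^ (s - 2) = 1 ∧ ∀ i, a ≤ i → i ≤ b → β' i = ζ ^ (n - 1 - i) * β i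

/-- Same family, and the same parameters: literally for `A1`, `A2`, `A3`, and up to an
`(s-2)`-th root of unity for `A4`, …, `A7`. -/
def SameParameters (n : ℕ) : Label → Label → Prop
  | A1 β, A1 β' => ∀ i, 2 ≤ i → i ≤ n - 1 → β' i = β i
  | A2 α β, A2 α' β' => α' = α ∧ β' = β
  | A3 r α, A3 r' α' => r' = r ∧ α' = α
  | A4 s α β, A4 s' α' β' => s' = s ∧ α' = α ∧ RootRelated n s s (n - 1) β β'
  | A5 s r α β, A5 s' r' α' β' =>
      s' = s ∧ r' = r ∧ α' = α ∧ RootRelated n s (s - r + 1) (n - r) β β'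
  | A6 s α β, A6 s' α' β' => s' = s ∧ α' = α ∧ RootRelated n s 2 (n - s + 1) β β'
  | A7 s α β, A7 s' α' β' => s' = s ∧ α' = α ∧ RootRelated n s 1 (n - s) β β'
  | _, _ => False

end Label

end Matching

end

open PowerSeries

namespace Matching

/-! Identify V with X ℂ⟦X⟧ modulo X^(n+1), with e_i = X^i, so that the first product is
multiplication of power series. The inner identity for ⋆ makes e_i ⋆ e_j depend on i + j only. The
inner identity for · gives e_1 · (e_1 ⋆ e_(j+1)) = (e_1 ⋆ e_1) · e_(j+1), and only multiples of e_n
are killed by e_1. With g = e_1 ⋆ e_1 this yields (X a) ⋆ (X b) = a b g + `lam` (a b) e_n, where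
`lam` is a functional with coefficients c_j and c_0 = 0 (`eq_stdProduct_of_is12Matching`).
Associativity on e_(j+1), e_1, e_1 becomes c_j (e_n ⋆ e_1) = 0. Hence either all c_j vanish and the
products are id-matching, or e_n ⋆ e_1 = 0, that is, c_(n-1) = -coeff 1 g. The latter condition is
also sufficient (`is12Matching_stdProduct`).

Automorphisms of the first product are the substitutions X ↦ X u with u a unit. They relate g and g'
by φ(g) = u² g' modulo e_n, and the corrections through the values of `lam` at X^j u^(j+2). If g has
a linear term, it can be made X, which gives A1. Otherwise it can be made α X² or α X² + X^s with 3
≤ s ≤ n - 1, by extracting an (s-2)-th root; α and s are invariants. What remains is the action on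
the corrections of those u that fix g.

For α X² every u is allowed: all entries below the last nonzero c_J can be cleared, and c_J can be
scaled unless J = n - 2. This gives A2 and A3. For α X² + X^s one has u = ζ v with ζ^(s-2) = 1 and v
≡ 1 modulo X^d, d = n - s, and the entry j = 0 receives the extra term (s-2) coeff d v. Perturbing v
by a X^k with k ≥ d changes the entry J - k by (J-k+2) a c_J and no higher one. This triangular
system prescribes all entries with j ≤ J - d (`exists_unit_lam_eq`), and its pivots can vanish only
for J = d at j = 0, where the pivot is 2 c_J - (s-2). So J = n - 2 gives A4, intermediate J gives
A5, and J = d gives A6 or A7 according to the pivot. The same triangularity leaves only ζ as freedom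
between normal forms (`eq_of_lam_eq`). -/

/-! ### Power series model of the null-filiform algebra -/

/-- The coefficients of `X, …, X ^ n` of a power series. -/
noncomputable def toV (n : ℕ) : ℂ⟦X⟧ →ₗ[ℂ] (Fin n → ℂ) :=
  LinearMap.pi fun i : Fin n => PowerSeries.coeff ((i : ℕ) + 1)

theorem toV_apply (n : ℕ) (y : ℂ⟦X⟧) (i : Fin n) : toV n y i = coeff ((i : ℕ) + 1) y := rfl

theorem toV_X_pow (n k : ℕ) : toV n (X ^ k) = e n k := by
  ext i
  simp [toV_apply, e, coeff_X_pow]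

theorem toV_eq_zero {n : ℕ} {y : ℂ⟦X⟧} (h : X ^ (n + 1) ∣ y) : toV n y = 0 := by
  ext i
  exact X_pow_dvd_iff.1 h _ (by omega)

theorem toV_eq_of_dvd {n : ℕ} {y z : ℂ⟦X⟧} (h : X ^ (n + 1) ∣ y - z) : toV n y = toV n z := by
  rw [← sub_eq_zero, ← map_sub]
  exact toV_eq_zero h

theorem toV_X_pow_mul (n : ℕ) (y : ℂ⟦X⟧) : toV n (X ^ n * y) = constantCoeff y • e n n := by
  ext i
  rcases Nat.lt_or_ge ((i : ℕ) + 1) n with h | h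
  · have : ¬ n ≤ (i : ℕ) + 1 := by omega
    simp [toV_apply, e, coeff_X_pow_mul', this, h.ne]
  · have h : n = (i : ℕ) + 1 := by omega
    simp only [toV_apply, e, ← h, Pi.smul_apply]
    rw [show coeff n (X ^ n * y) = coeff (0 + n) (X ^ n * y) by rw [zero_add], coeff_X_pow_mul]
    simp

theorem exists_toV (n : ℕ) (v : Fin n → ℂ) : ∃ a : ℂ⟦X⟧, toV n (X * a) = v := by
  refine ⟨PowerSeries.mk fun k => if h : k < n then v ⟨k, h⟩ else 0, ?_⟩
  ext i
  simp [toV_apply, coeff_succ_X_mul]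

/-- A product depending only on `i + j` is evaluated through the product of power series. -/
theorem ofSum_toV {n : ℕ} {f : ℕ → Fin n → ℂ} (hf : ∀ m, n + 1 < m → f m = 0) (a b : ℂ⟦X⟧) :
    ofSum n f (toV n (X * a)) (toV n (X * b)) =
      ∑ j ∈ Finset.range n, coeff j (a * b) • f (j + 2) := by
  have h1 : ofSum n f (toV n (X * a)) (toV n (X * b)) =
      ∑ i ∈ Finset.range n, ∑ j ∈ Finset.range n, (coeff i a * coeff j b) • f (i + j + 2) := by
    simp only [ofSum, LinearMap.mk₂_apply, Finset.sum_range, toV_apply, coeff_succ_X_mul]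
    refine Finset.sum_congr rfl fun i _ => Finset.sum_congr rfl fun j _ => ?_
    congr 2
    ring
  rw [h1, ← Finset.sum_product']
  simp only [coeff_mul, Finset.sum_smul]
  rw [Finset.sum_sigma']
  symm
  -- The antidiagonals fill the triangle i + j < n of the square; outside it i + j + 2 > n + 1,
  -- where `f` vanishes.
  refine Finset.sum_of_injOn (fun x => (x.2.1, x.2.2)) ?_ ?_ ?_ ?_
  · rintro ⟨k, x⟩ hx ⟨k', x'⟩ hx' h
    simp only [Finset.coe_sigma, Set.mem_sigma_iff, Finset.mem_coe, Finset.mem_range] at hx hx'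
    have h1 := Finset.HasAntidiagonal.mem_antidiagonal.1 hx.2
    have h2 := Finset.HasAntidiagonal.mem_antidiagonal.1 hx'.2
    have hxx : x = x' := Prod.ext (Prod.ext_iff.1 h).1 (Prod.ext_iff.1 h).2
    subst hxx
    have : k = k' := by exact h1.symm.trans h2
    subst this
    rfl
  · rintro ⟨k, x⟩ hx
    simp only [Finset.coe_sigma, Set.mem_sigma_iff, Finset.mem_coe, Finset.mem_range,
      Finset.mem_product] at hx ⊢
    have h1 := Finset.HasAntidiagonal.mem_antidiagonal.1 hx.2
    omega
  · rintro ⟨i, j⟩ _ h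
    have : n + 1 < i + j + 2 := by
      by_contra hc
      exact h ⟨⟨i + j, (i, j)⟩, by simpa using by omega, rfl⟩
    simp only
    rw [hf _ this, smul_zero]
  · rintro ⟨k, x⟩ hx
    have h1 := Finset.HasAntidiagonal.mem_antidiagonal.1 (Finset.mem_sigma.1 hx).2
    simp only at h1
    simp only [← h1]

theorem mu_toV (n : ℕ) (a b : ℂ⟦X⟧) :
    mu n (toV n (X * a)) (toV n (X * b)) = toV n (X ^ 2 * (a * b)) := by
  rw [mu, ofSum_toV]
  · ext i
    simp only [Finset.sum_apply, Pi.smul_apply, e, toV_apply, coeff_X_pow_mul', smul_eq_mul,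
      mul_ite, mul_one, mul_zero]
    split_ifs with h
    · rw [Finset.sum_eq_single ((i : ℕ) + 1 - 2)]
      · rw [if_pos (by omega)]
      · intro j _ hj
        rw [if_neg (by omega)]
      · intro hj
        exact absurd (Finset.mem_range.2 (by omega)) hj
    · exact Finset.sum_eq_zero fun j _ => if_neg (by omega)
  · intro m hm
    ext i
    simp only [e, Pi.zero_apply]
    rw [if_neg (by omega)]

/-! ### Products determined by a power series and a functional -/

/-- The functional `y ↦ ∑_{j < n} c_j y_j` on power series. -/
noncomputable def lam (n : ℕ) (c : ℕ → ℂ) : ℂ⟦X⟧ →ₗ[ℂ] ℂ :=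
  ∑ j ∈ Finset.range n, c j • PowerSeries.coeff j

theorem lam_apply (n : ℕ) (c : ℕ → ℂ) (y : ℂ⟦X⟧) :
    lam n c y = ∑ j ∈ Finset.range n, c j * coeff j y := by
  simp [lam]

theorem lam_eq_zero {n k : ℕ} {c : ℕ → ℂ} {y : ℂ⟦X⟧} (hy : X ^ k ∣ y)
    (hc : ∀ j, k ≤ j → j < n → c j = 0) : lam n c y = 0 := by
  rw [lam_apply]
  refine Finset.sum_eq_zero fun j hj => ?_
  rcases Nat.lt_or_ge j k with h | h
  · rw [X_pow_dvd_iff.1 hy j h, mul_zero]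
  · rw [hc j h (Finset.mem_range.1 hj), zero_mul]

theorem lam_X_pow {n j : ℕ} (c : ℕ → ℂ) (hj : j < n) : lam n c (X ^ j) = c j := by
  rw [lam_apply, Finset.sum_eq_single j]
  · simp
  · intro k _ hk
    simp [coeff_X_pow, hk]
  · intro h
    exact absurd (Finset.mem_range.2 hj) h

/-- If `c_j = 0` for `j > k`, only the leading term of `X ^ k * y` contributes. -/
theorem lam_X_pow_mul {n k : ℕ} {c : ℕ → ℂ} (hk : k < n) (hc : ∀ j, k < j → j < n → c j = 0)
    (y : ℂ⟦X⟧) : lam n c (X ^ k * y) = constantCoeff y * c k := by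
  have h : X ^ (k + 1) ∣ X ^ k * y - constantCoeff y • X ^ k := by
    have : X ∣ y - C (constantCoeff y) := by simp [X_dvd_iff]
    obtain ⟨w, hw⟩ := this
    refine ⟨w, ?_⟩
    rw [smul_eq_C_mul, pow_succ, mul_assoc, ← hw]
    ring
  have h2 := lam_eq_zero (n := n) (c := c) h fun j hj hjn => hc j hj hjn
  rw [map_sub, map_smul, lam_X_pow c hk, sub_eq_zero] at h2
  exact h2

/-- The values `X ^ (m - 2) * g + c_{m-2} e_n` for `m ≤ n + 1`. -/
noncomputable def std (n : ℕ) (g : ℂ⟦X⟧) (c : ℕ → ℂ) (m : ℕ) : Fin n → ℂ :=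
  if m ≤ n + 1 then toV n (X ^ (m - 2) * g) + c (m - 2) • e n n else 0

/-- The product with `(X a) * (X b) = a b g + lam (a b) e_n`. -/
noncomputable def stdProduct (n : ℕ) (g : ℂ⟦X⟧) (c : ℕ → ℂ) : Product (Fin n → ℂ) :=
  ofSum n (std n g c)

theorem stdProduct_toV {n : ℕ} {g : ℂ⟦X⟧} (hg : constantCoeff g = 0) (c : ℕ → ℂ) (a b : ℂ⟦X⟧) :
    stdProduct n g c (toV n (X * a)) (toV n (X * b)) =
      toV n (a * b * g) + lam n c (a * b) • e n n := by
  rw [stdProduct, ofSum_toV (fun m hm => by rw [std, if_neg (by omega)])]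
  set y := a * b
  have h1 : ∀ j ∈ Finset.range n, coeff j y • std n g c (j + 2) =
      toV n (coeff j y • (X ^ j * g)) + (c j * coeff j y) • e n n := by
    intro j hj
    have := Finset.mem_range.1 hj
    rw [std, if_pos (by omega), smul_add, map_smul, smul_smul, mul_comm (c j)]
    simp
  rw [Finset.sum_congr rfl h1, Finset.sum_add_distrib, ← Finset.sum_smul, ← lam_apply, ← map_sum]
  congr 1
  symm
  apply toV_eq_of_dvd
  -- Truncating y below X^n is harmless: the tail is divisible by X^n and g contributes one more
  -- factor X.
  have h2 : y * g - ∑ j ∈ Finset.range n, coeff j y • (X ^ j * g) =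
      (y - ∑ j ∈ Finset.range n, coeff j y • X ^ j) * g := by
    simp only [sub_mul, Finset.sum_mul, smul_mul_assoc]
  rw [h2, pow_succ]
  refine mul_dvd_mul ?_ (X_dvd_iff.2 hg)
  rw [X_pow_dvd_iff]
  intro m hm
  simp [coeff_X_pow, hm]

theorem stdProduct_congr {n : ℕ} {g : ℂ⟦X⟧} {c : ℕ → ℂ} {f : ℕ → Fin n → ℂ}
    (h : ∀ j, j < n → f (j + 2) = toV n (X ^ j * g) + c j • e n n)
    (hf : ∀ m, n + 1 < m → f m = 0) : ofSum n f = stdProduct n g c := by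
  refine LinearMap.ext fun v => LinearMap.ext fun w => ?_
  obtain ⟨a, rfl⟩ := exists_toV n v
  obtain ⟨b, rfl⟩ := exists_toV n w
  rw [stdProduct, ofSum_toV hf, ofSum_toV (fun m hm => by rw [std, if_neg (by omega)])]
  refine Finset.sum_congr rfl fun j hj => ?_
  have := Finset.mem_range.1 hj
  rw [h j this, std, if_pos (by omega)]
  simp

theorem e_eq_toV (n : ℕ) {k : ℕ} (hk : 1 ≤ k) : e n k = toV n (X * X ^ (k - 1)) := by
  rw [← pow_succ', Nat.sub_add_cancel hk, toV_X_pow]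

/-- The hypothesis on c (n - 1) says e_n ⋆ e_1 = 0: the term X^(n-1) g contributes coeff 1 g to e_n
and the functional cancels it. Multiples of X^(n-1) then give nothing either. -/
theorem stdProduct_top {n : ℕ} (hn : 1 ≤ n) {g : ℂ⟦X⟧} (hg : constantCoeff g = 0) {c : ℕ → ℂ}
    (hc : c (n - 1) = -coeff 1 g) (y : ℂ⟦X⟧) :
    toV n (X ^ (n - 1) * y * g) + lam n c (X ^ (n - 1) * y) • e n n = 0 := by
  obtain ⟨g', rfl⟩ := X_dvd_iff.2 hg
  rw [lam_X_pow_mul (by omega) (fun j h1 h2 => by omega), hc]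
  have : X ^ (n - 1) * y * (X * g') = X ^ n * (y * g') := by
    obtain ⟨m, rfl⟩ := Nat.exists_eq_add_of_le' hn
    simp only [Nat.add_sub_cancel]
    ring
  rw [this, toV_X_pow_mul, ← add_smul]
  simp [coeff_succ_X_mul]

theorem stdProduct_mul_X_toV {n : ℕ} (hn : 1 ≤ n) (g : ℂ⟦X⟧) (c : ℕ → ℂ) (a b : ℂ⟦X⟧) :
    stdProduct n (X * g) c (toV n (X * a)) (toV n (X * b)) =
      toV n (X * (a * b * g + X ^ (n - 1) * C (lam n c (a * b)))) := by
  rw [stdProduct_toV (by simp), mul_add, map_add, ← mul_assoc X (X ^ (n - 1)), ← pow_succ',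
    Nat.sub_add_cancel hn, toV_X_pow_mul]
  simp only [constantCoeff_C]
  congr 2
  ring

theorem mu_assoc (n : ℕ) : IsAssoc (mu n) := by
  intro v w z
  obtain ⟨a, rfl⟩ := exists_toV n v
  obtain ⟨b, rfl⟩ := exists_toV n w
  obtain ⟨c, rfl⟩ := exists_toV n z
  rw [mu_toV, mu_toV, pow_two, mul_assoc X X, mul_assoc X X, mu_toV, mu_toV]
  congr 1
  ring

/-- Multiples of e_n are annihilated by both products, so every double product depends only on the
product of the three series. -/
theorem is12Matching_stdProduct {n : ℕ} (hn : 1 ≤ n) {g : ℂ⟦X⟧} (hg : constantCoeff g = 0)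
    {c : ℕ → ℂ} (hc : c (n - 1) = -coeff 1 g) : Is12Matching (mu n) (stdProduct n g c) := by
  obtain ⟨g', rfl⟩ := X_dvd_iff.2 hg
  refine ⟨mu_assoc n, ?_, ?_, ?_⟩ <;> intro v w z <;>
    obtain ⟨x, rfl⟩ := exists_toV n v <;> obtain ⟨y, rfl⟩ := exists_toV n w <;>
    obtain ⟨z, rfl⟩ := exists_toV n z
  · have key : ∀ a (r : ℂ) b, stdProduct n (X * g') c (toV n (X * (a + X ^ (n - 1) * C r)))
        (toV n (X * b)) = stdProduct n (X * g') c (toV n (X * a)) (toV n (X * b)) := by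
      intro a r b
      rw [stdProduct_toV hg, stdProduct_toV hg]
      have h := stdProduct_top hn hg hc (C r * b)
      rw [show (a + X ^ (n - 1) * C r) * b = a * b + X ^ (n - 1) * (C r * b) by ring, add_mul,
        map_add, map_add, add_smul, add_add_add_comm, h, add_zero]
    have key' : ∀ a (r : ℂ) b, stdProduct n (X * g') c (toV n (X * b))
        (toV n (X * (a + X ^ (n - 1) * C r))) =
        stdProduct n (X * g') c (toV n (X * b)) (toV n (X * a)) := by
      intro a r b
      have := key a r b
      rwa [stdProduct_toV hg, stdProduct_toV hg, mul_comm _ b, mul_comm _ b, ← stdProduct_toV hg,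
        ← stdProduct_toV hg] at this
    rw [stdProduct_mul_X_toV hn g' c x y, stdProduct_mul_X_toV hn g' c y z, key, key',
      stdProduct_toV hg,
      stdProduct_toV hg]
    congr 2 <;> ring_nf
  · rw [mu_toV, mu_toV, pow_two, mul_assoc X X, mul_assoc X X, stdProduct_toV hg,
      stdProduct_toV hg]
    congr 2 <;> ring_nf
  · rw [stdProduct_mul_X_toV hn, stdProduct_mul_X_toV hn, mu_toV, mu_toV]
    apply toV_eq_of_dvd
    obtain ⟨m, rfl⟩ := Nat.exists_eq_add_of_le' hn
    refine ⟨C (lam (m + 1) c (x * y)) * z - C (lam (m + 1) c (y * z)) * x, ?_⟩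
    simp only [Nat.add_sub_cancel]
    ring

/-! ### Structure of (12)-matching products -/

/-- A product for which `(a · b) ⋆ c = a ⋆ (b · c)` depends on `i + j` only. -/
theorem star_toV_of_inner {n : ℕ} {star : Product (Fin n → ℂ)}
    (h : ∀ a b c, star (mu n a b) c = star a (mu n b c)) (i j : ℕ) :
    star (e n (i + 1)) (e n (j + 1)) = star (e n 1) (e n (i + j + 1)) := by
  induction i generalizing j with
  | zero => rw [Nat.zero_add, Nat.zero_add]
  | succ i ih =>
    have hm : ∀ k, mu n (e n 1) (e n (k + 1)) = e n (k + 2) := by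
      intro k
      rw [e_eq_toV n le_rfl, e_eq_toV n (Nat.le_add_left 1 k), mu_toV, e_eq_toV n (by omega)]
      simp only [Nat.sub_self, Nat.add_sub_cancel]
      congr 1
      rw [show k + 2 - 1 = k + 1 by omega]
      ring
    have hm' : mu n (e n (i + 1)) (e n 1) = e n (i + 2) := by
      rw [e_eq_toV n le_rfl, e_eq_toV n (Nat.le_add_left 1 i), mu_toV, e_eq_toV n (by omega)]
      simp only [Nat.sub_self, Nat.add_sub_cancel]
      congr 1
      rw [show i + 2 - 1 = i + 1 by omega]
      ring
    rw [← hm', h, hm, ih (j + 1)]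
    congr 2
    ring

theorem basisFun_eq_e (n : ℕ) (i : Fin n) : Pi.basisFun ℂ (Fin n) i = e n ((i : ℕ) + 1) := by
  ext j
  simp [e, Pi.single_apply, Fin.ext_iff]

theorem ext_e {n : ℕ} {M : Type*} [AddCommGroup M] [Module ℂ M]
    {B B' : (Fin n → ℂ) →ₗ[ℂ] (Fin n → ℂ) →ₗ[ℂ] M}
    (h : ∀ i j, i < n → j < n → B (e n (i + 1)) (e n (j + 1)) = B' (e n (i + 1)) (e n (j + 1))) :
    B = B' := by
  refine LinearMap.ext_basis (Pi.basisFun ℂ (Fin n)) (Pi.basisFun ℂ (Fin n)) fun i j => ?_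
  rw [basisFun_eq_e, basisFun_eq_e]
  exact h i j i.2 j.2

theorem ofSum_e {n : ℕ} {f : ℕ → Fin n → ℂ} {i j : ℕ} (hi : i < n) (hj : j < n) :
    ofSum n f (e n (i + 1)) (e n (j + 1)) = f (i + j + 2) := by
  simp only [ofSum, LinearMap.mk₂_apply, e]
  rw [Finset.sum_eq_single ⟨i, hi⟩, Finset.sum_eq_single ⟨j, hj⟩]
  · simp only [if_true, mul_one, one_smul]
    congr 1
    ring
  · intro b _ hb
    rw [if_neg (c := (b : ℕ) + 1 = j + 1) (fun h => hb (Fin.ext (by simpa using h)))]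
    simp
  · simp
  · intro b _ hb
    refine Finset.sum_eq_zero fun k _ => ?_
    rw [if_neg (c := (b : ℕ) + 1 = i + 1) (fun h => hb (Fin.ext (by simpa using h)))]
    simp
  · simp

theorem eq_smul_e_of_mu {n : ℕ} (hn : 1 ≤ n) {v w : Fin n → ℂ}
    (h : mu n (e n 1) v = mu n (e n 1) w) : ∃ r : ℂ, v = w + r • e n n := by
  refine ⟨(v - w) ⟨n - 1, by omega⟩, ?_⟩
  obtain ⟨a, rfl⟩ := exists_toV n v
  obtain ⟨b, rfl⟩ := exists_toV n w
  rw [e_eq_toV n le_rfl, mu_toV, mu_toV] at h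
  ext i
  rcases Nat.lt_or_ge ((i : ℕ) + 1) n with hi | hi
  · have := congrFun h ⟨(i : ℕ) + 1, hi⟩
    simp only [toV_apply, coeff_X_pow_mul', Nat.sub_self, pow_zero, one_mul] at this
    rw [if_pos (by omega), if_pos (by omega)] at this
    simp only [Pi.add_apply, Pi.smul_apply, e, hi.ne, if_false, smul_zero, add_zero, toV_apply,
      coeff_succ_X_mul]
    exact this
  · have h1 : (⟨n - 1, by omega⟩ : Fin n) = i := Fin.ext (by simp only; omega)
    have h2 : (i : ℕ) + 1 = n := by omega
    simp [h1, e, h2]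

/-- Structure of a `(12)`-matching product on the null-filiform algebra. -/
theorem eq_stdProduct_of_is12Matching {n : ℕ} (hn : 1 ≤ n) {star : Product (Fin n → ℂ)}
    (h : Is12Matching (mu n) star) {g : ℂ⟦X⟧} (hg : constantCoeff g = 0) {r : ℂ}
    (h1 : star (e n 1) (e n 1) = toV n g + r • e n n) :
    ∃ c : ℕ → ℂ, c 0 = r ∧ star = stdProduct n g c := by
  have hs := star_toV_of_inner h.star_inner
  have key : ∀ j, ∃ c : ℂ, (j = 0 → c = r) ∧
      star (e n 1) (e n (j + 1)) = toV n (X ^ j * g) + c • e n n := by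
    intro j
    rcases Nat.eq_zero_or_pos j with rfl | hj
    · exact ⟨r, fun _ => rfl, by simpa using h1⟩
    · have h2 := h.dot_inner (e n 1) (e n 1) (e n (j + 1))
      obtain ⟨g', rfl⟩ := X_dvd_iff.2 hg
      rw [h1, e_eq_toV n hn, e_eq_toV n (Nat.le_add_left 1 j)] at h2
      have h3 : toV n (X * g') + r • toV n (X * X ^ (n - 1)) =
          toV n (X * (g' + X ^ (n - 1) * C r)) := by
        rw [← map_smul, ← map_add, smul_eq_C_mul]
        congr 1
        ring
      rw [h3, mu_toV, ← e_eq_toV n (Nat.le_add_left 1 j), Nat.add_sub_cancel] at h2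
      obtain ⟨c, hc⟩ := eq_smul_e_of_mu hn (v := star (e n 1) (e n (j + 1)))
        (w := toV n (X ^ j * (X * g'))) (by
          rw [← h2, e_eq_toV n le_rfl, show X ^ j * (X * g') = X * (X ^ j * g') by ring, mu_toV]
          apply toV_eq_of_dvd
          obtain ⟨m, rfl⟩ := Nat.exists_eq_add_of_le' hn
          obtain ⟨k, rfl⟩ := Nat.exists_eq_add_of_le' hj
          refine ⟨C r * X ^ (k + 1), ?_⟩
          simp only [Nat.add_sub_cancel, Nat.sub_self]
          ring)
      exact ⟨c, fun h => absurd h hj.ne', hc⟩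
  choose c hc0 hc using key
  refine ⟨c, hc0 0 rfl, ext_e fun i j hi hj => ?_⟩
  rw [hs, stdProduct, ofSum_e hi hj, std]
  split_ifs with hij
  · rw [hc]
    rfl
  · have : e n (i + j + 1) = 0 := by
      rw [← toV_X_pow]
      exact toV_eq_zero (pow_dvd_pow _ (by omega))
    rw [this, map_zero]

/-- Without corrections, (X a) ⋆ (X b) = X (a b g') for the fixed series g' = g / X; both products
are then commutative multiplication up to a fixed factor. -/
theorem isIdMatching_stdProduct {n : ℕ} {g : ℂ⟦X⟧} (hg : constantCoeff g = 0)
    {c : ℕ → ℂ} (hc : ∀ j, j < n → c j = 0) : IsIdMatching (mu n) (stdProduct n g c) := by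
  obtain ⟨g', rfl⟩ := X_dvd_iff.2 hg
  have hs : ∀ a b, stdProduct n (X * g') c (toV n (X * a)) (toV n (X * b)) =
      toV n (X * (a * b * g')) := by
    intro a b
    rw [stdProduct_toV hg, lam_eq_zero (k := 0) (by simp) fun j _ h => hc j h, zero_smul, add_zero]
    congr 1
    ring
  have hm : ∀ a b, mu n (toV n (X * a)) (toV n (X * b)) = toV n (X * (X * (a * b))) := by
    intro a b
    rw [mu_toV]
    congr 1
    ring
  refine ⟨mu_assoc n, ?_, ?_, ?_⟩ <;> intro v w z <;>
    obtain ⟨x, rfl⟩ := exists_toV n v <;> obtain ⟨y, rfl⟩ := exists_toV n w <;>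
    obtain ⟨z, rfl⟩ := exists_toV n z <;> simp only [hs, hm] <;> congr 1 <;> ring

/-- A `(12)`-matching product is `id`-matching or annihilates `e_1 ⊗ e_n`. -/
theorem isIdMatching_or_exists_stdProduct {n : ℕ} (hn : 1 ≤ n) {star : Product (Fin n → ℂ)}
    (h : Is12Matching (mu n) star) : IsIdMatching (mu n) star ∨
      ∃ (g : ℂ⟦X⟧) (c : ℕ → ℂ), constantCoeff g = 0 ∧ c (n - 1) = -coeff 1 g ∧
        star = stdProduct n g c := by
  obtain ⟨g', hg'⟩ := exists_toV n (star (e n 1) (e n 1))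
  have hg : constantCoeff (X * g') = 0 := by simp
  -- All of e_1 ⋆ e_1, including its e_n-component, is put into g; hence c 0 = 0.
  obtain ⟨c, hc0, hc⟩ := eq_stdProduct_of_is12Matching hn h hg (r := 0) (by simp [hg'])
  by_cases hc1 : c (n - 1) = -coeff 1 (X * g')
  · exact Or.inr ⟨_, c, hg, hc1, hc⟩
  left
  have htop : stdProduct n (X * g') c (toV n (X * X ^ (n - 1))) (toV n (X * 1)) ≠ 0 := by
    rw [stdProduct_toV hg, mul_one, lam_X_pow c (by omega),
      show X ^ (n - 1) * (X * g') = X ^ (n - 1 + 1) * g' by ring, Nat.sub_add_cancel hn,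
      toV_X_pow_mul, ← add_smul]
    intro h0
    have := congrFun h0 ⟨n - 1, by omega⟩
    simp only [Pi.smul_apply, e, Nat.sub_add_cancel hn, if_true, smul_eq_mul, mul_one,
      Pi.zero_apply] at this
    apply hc1
    rw [show coeff 1 (X * g') = constantCoeff g' by
      rw [show (1 : ℕ) = 0 + 1 by rfl, coeff_succ_X_mul]; simp]
    linear_combination this
  subst hc
  refine isIdMatching_stdProduct hg fun j hj => ?_
  rcases Nat.eq_zero_or_pos j with rfl | hj0
  · exact hc0
  -- The two sides differ by c_j (e_n ⋆ e_1), and e_n ⋆ e_1 is nonzero in this case.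
  have hassoc := h.star_assoc (toV n (X * X ^ j)) (toV n (X * 1)) (toV n (X * 1))
  rw [stdProduct_mul_X_toV hn g' c (X ^ j) 1, stdProduct_mul_X_toV hn g' c 1 1] at hassoc
  simp only [mul_one, one_mul] at hassoc
  have h00 : lam n c 1 = 0 := by
    rw [← pow_zero X, lam_X_pow c (by omega), hc0]
  rw [lam_X_pow c hj, h00, map_zero, mul_zero, add_zero, mul_add, map_add, map_add,
    show X * (X ^ (n - 1) * C (c j)) = (c j) • (X * X ^ (n - 1)) by rw [smul_eq_C_mul]; ring,
    map_smul, map_smul, LinearMap.add_apply, LinearMap.smul_apply] at hassoc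
  have hcomm : stdProduct n (X * g') c (toV n (X * (X ^ j * g'))) (toV n X) =
      stdProduct n (X * g') c (toV n (X * X ^ j)) (toV n (X * g')) := by
    have := stdProduct_toV hg c (n := n) (X ^ j * g') 1
    rw [mul_one, mul_one] at this
    rw [this, stdProduct_toV hg]
  rw [hcomm] at hassoc
  have h0 := add_eq_left.1 hassoc
  rw [mul_one] at htop
  exact (smul_eq_zero.1 h0).resolve_right htop

/-! ### Isomorphisms and substitutions -/

section Isomorphic

variable {U V W : Type*} [AddCommGroup U] [Module ℂ U] [AddCommGroup V] [Module ℂ V]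
  [AddCommGroup W] [Module ℂ W]

theorem Isomorphic.refl (dot star : Product V) : Isomorphic dot star dot star :=
  ⟨LinearEquiv.refl ℂ V, fun _ _ => rfl, fun _ _ => rfl⟩

theorem Isomorphic.symm {dot star : Product V} {dot' star' : Product W}
    (h : Isomorphic dot star dot' star') : Isomorphic dot' star' dot star := by
  obtain ⟨φ, h1, h2⟩ := h
  refine ⟨φ.symm, fun a b => ?_, fun a b => ?_⟩
  · rw [LinearEquiv.symm_apply_eq, h1]
    simp
  · rw [LinearEquiv.symm_apply_eq, h2]
    simp

theorem Isomorphic.trans {dot star : Product U} {dot' star' : Product V}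
    {dot'' star'' : Product W} (h : Isomorphic dot star dot' star')
    (h' : Isomorphic dot' star' dot'' star'') : Isomorphic dot star dot'' star'' := by
  obtain ⟨φ, h1, h2⟩ := h
  obtain ⟨ψ, h3, h4⟩ := h'
  exact ⟨φ.trans ψ, fun a b => by simp [h1, h3], fun a b => by simp [h2, h4]⟩

theorem Is12Matching.pullback {dot star : Product V} (h : Is12Matching dot star)
    (φ : V ≃ₗ[ℂ] V) (hφ : ∀ a b, φ (dot a b) = dot (φ a) (φ b)) :
    ∃ star' : Product V, Is12Matching dot star' ∧
      ∀ a b, φ (star' a b) = star (φ a) (φ b) := by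
  have hs : ∀ a b, φ (((star.compl₁₂ φ.toLinearMap φ.toLinearMap).compr₂ φ.symm.toLinearMap) a b) =
      star (φ a) (φ b) := by
    intro a b
    simp
  refine ⟨_, ⟨h.dot_assoc, ?_, ?_, ?_⟩, hs⟩ <;> intro a b c <;> apply φ.injective
  · rw [hs, hs, hs, hs, h.star_assoc]
  · rw [hs, hs, hφ, hφ, h.star_inner]
  · rw [hφ, hφ, hs, hs, h.dot_inner]

end Isomorphic

/-- The automorphism of the null-filiform algebra sending `e_1` to `X u`. -/
theorem exists_aut (n : ℕ) {u : ℂ⟦X⟧} (hu : constantCoeff u ≠ 0) :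
    ∃ φ : (Fin n → ℂ) ≃ₗ[ℂ] (Fin n → ℂ), (∀ k, φ (toV n (X ^ k)) = toV n ((X * u) ^ k)) ∧
      ∀ a b, φ (mu n a b) = mu n (φ a) (φ b) := by
  let f : (Fin n → ℂ) →ₗ[ℂ] (Fin n → ℂ) :=
    (Pi.basisFun ℂ (Fin n)).constr ℂ fun i => toV n ((X * u) ^ ((i : ℕ) + 1))
  have hf : ∀ k, f (toV n (X ^ k)) = toV n ((X * u) ^ k) := by
    intro k
    rcases Nat.eq_zero_or_pos k with rfl | hk
    · have : toV n (X ^ 0) = 0 := by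
        ext i
        simp [toV_apply, coeff_one]
      rw [this, map_zero, pow_zero, ← pow_zero X, this]
    rcases Nat.lt_or_ge n k with h | h
    · rw [toV_eq_zero (pow_dvd_pow _ h), map_zero, mul_pow, toV_eq_zero]
      exact (pow_dvd_pow _ h).mul_right _
    · obtain ⟨m, rfl⟩ := Nat.exists_eq_add_of_le' hk
      have := (Pi.basisFun ℂ (Fin n)).constr_basis ℂ
        (fun i => toV n ((X * u) ^ ((i : ℕ) + 1))) ⟨m, h⟩
      rw [basisFun_eq_e] at this
      rw [toV_X_pow]
      exact this
  have hinj : Function.Injective f := by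
    rw [← LinearMap.ker_eq_bot, LinearMap.ker_eq_bot']
    intro v hv
    by_contra hv0
    obtain ⟨i, hi⟩ := Function.ne_iff.1 hv0
    -- The lowest nonzero coordinate is only multiplied by a power of the constant term of u, so it
    -- survives.
    have hex : ∃ k : ℕ, ∃ h : k < n, v ⟨k, h⟩ ≠ 0 := ⟨i, i.2, hi⟩
    classical
    obtain ⟨hk, hvk⟩ := Nat.find_spec hex
    set k := Nat.find hex
    have hmin : ∀ j : Fin n, (j : ℕ) < k → v j = 0 := by
      intro j hj
      by_contra hc
      exact Nat.find_min hex hj ⟨j.2, hc⟩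
    have h1 : f v ⟨k, hk⟩ = v ⟨k, hk⟩ * constantCoeff u ^ (k + 1) := by
      simp only [f, Module.Basis.constr_apply_fintype, Finset.sum_apply, Pi.smul_apply, toV_apply,
        mul_pow]
      rw [Finset.sum_eq_single ⟨k, hk⟩]
      · rw [show coeff (k + 1) (X ^ (k + 1) * u ^ (k + 1)) =
          coeff (0 + (k + 1)) (X ^ (k + 1) * u ^ (k + 1)) by rw [zero_add], coeff_X_pow_mul]
        simp
      · intro j _ hj
        rcases Nat.lt_or_ge (j : ℕ) k with h | h
        · simp [hmin j h]
        · have : (j : ℕ) ≠ k := fun h => hj (Fin.ext h)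
          rw [coeff_X_pow_mul', if_neg (by omega), smul_zero]
      · simp
    rw [hv] at h1
    exact mul_ne_zero hvk (pow_ne_zero _ hu) h1.symm
  refine ⟨LinearEquiv.ofInjectiveEndo f hinj, hf, ?_⟩
  have hmu : (mu n).compr₂ f = (mu n).compl₁₂ f f := by
    refine ext_e fun i j _ _ => ?_
    simp only [LinearMap.compr₂_apply, LinearMap.compl₁₂_apply]
    rw [← toV_X_pow, ← toV_X_pow, hf, hf, pow_succ', pow_succ', pow_succ', pow_succ', mu_toV,
      mul_assoc, mul_assoc, mu_toV, ← pow_add, ← pow_add, hf]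
    congr 1
    ring
  exact fun a b => LinearMap.congr_fun₂ hmu a b

/-- The algebra is generated by e_1, so the image X u of e_1 determines φ. A vanishing constant term
of u would send e_n to 0. -/
theorem exists_unit_of_aut {n : ℕ} (hn : 1 ≤ n) (φ : (Fin n → ℂ) ≃ₗ[ℂ] (Fin n → ℂ))
    (hφ : ∀ a b, φ (mu n a b) = mu n (φ a) (φ b)) :
    ∃ u : ℂ⟦X⟧, constantCoeff u ≠ 0 ∧ ∀ k, φ (toV n (X ^ k)) = toV n ((X * u) ^ k) := by
  obtain ⟨u, hu⟩ := exists_toV n (φ (toV n (X ^ 1)))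
  have key : ∀ k, φ (toV n (X ^ k)) = toV n ((X * u) ^ k) := by
    intro k
    rcases Nat.eq_zero_or_pos k with rfl | hk
    · have : toV n (X ^ 0) = 0 := by
        ext i
        simp [toV_apply, coeff_one]
      rw [this, map_zero, pow_zero, ← pow_zero X, this]
    induction k, hk using Nat.le_induction with
    | base => rw [pow_one (X * u), hu]
    | succ k hk ih =>
      obtain ⟨m, rfl⟩ := Nat.exists_eq_add_of_le' hk
      have h1 : toV n (X ^ (m + 1 + 1)) = mu n (toV n (X ^ 1)) (toV n (X ^ (m + 1))) := by
        rw [pow_succ' X 0, pow_succ' X m, mu_toV]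
        congr 1
        ring
      rw [h1, hφ, ih, ← hu, pow_succ' (X * u) m, mul_assoc X u, mu_toV]
      congr 1
      ring
  refine ⟨u, fun h0 => ?_, key⟩
  have h1 : toV n (X ^ n) = 0 := by
    apply φ.injective
    rw [key, map_zero, mul_pow]
    apply toV_eq_zero
    rw [pow_succ]
    refine mul_dvd_mul_left _ ((X_dvd_iff.2 h0).trans (dvd_pow_self u (by omega)))
  have h2 := congrFun h1 ⟨n - 1, by omega⟩
  simp [toV_apply, Nat.sub_add_cancel hn] at h2

/-- An isomorphism `e_1 ↦ X u` between two products in standard form. -/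
theorem exists_unit_of_isomorphic {n : ℕ} (hn : 1 ≤ n) {g g' : ℂ⟦X⟧} (hg : constantCoeff g = 0)
    (hg' : constantCoeff g' = 0) {c c' : ℕ → ℂ}
    (h : Isomorphic (mu n) (stdProduct n g c) (mu n) (stdProduct n g' c')) :
    ∃ (φ : (Fin n → ℂ) ≃ₗ[ℂ] (Fin n → ℂ)) (u : ℂ⟦X⟧), constantCoeff u ≠ 0 ∧
      (∀ k, φ (toV n (X ^ k)) = toV n ((X * u) ^ k)) ∧
      ∀ j, j < n → φ (toV n (X ^ j * g)) + (c j * constantCoeff u ^ n) • e n n =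
        toV n (X ^ j * u ^ (j + 2) * g') + lam n c' (X ^ j * u ^ (j + 2)) • e n n := by
  obtain ⟨φ, hmu, hs⟩ := h
  obtain ⟨u, hu, hφ⟩ := exists_unit_of_aut hn φ hmu
  refine ⟨φ, u, hu, hφ, fun j hj => ?_⟩
  have hen : φ (e n n) = constantCoeff u ^ n • e n n := by
    rw [← toV_X_pow, hφ, mul_pow, toV_X_pow_mul, map_pow, toV_X_pow]
  have h1 := hs (toV n (X ^ 1)) (toV n (X ^ (j + 1)))
  rw [hφ, hφ, pow_succ', pow_succ', pow_succ', pow_succ', mul_assoc X u, mul_assoc X u,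
    stdProduct_toV hg, stdProduct_toV hg', map_add, map_smul, hen, smul_smul,
    pow_zero, one_mul, lam_X_pow c hj] at h1
  rw [h1, pow_zero, mul_one, mul_pow,
    show u * (u * (X ^ j * u ^ j)) = X ^ j * u ^ (j + 2) by ring]

/-- Converse of `exists_unit_of_isomorphic`: both sides depend on i + j only, so testing e_1 against
every basis vector is enough, and for i + j ≥ n everything is zero. -/
theorem isomorphic_of_aut {n : ℕ} {g g' : ℂ⟦X⟧} (hg : constantCoeff g = 0)
    (hg' : constantCoeff g' = 0) {c c' : ℕ → ℂ} {φ : (Fin n → ℂ) ≃ₗ[ℂ] (Fin n → ℂ)}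
    {u : ℂ⟦X⟧} (hφ : ∀ k, φ (toV n (X ^ k)) = toV n ((X * u) ^ k))
    (hmu : ∀ a b, φ (mu n a b) = mu n (φ a) (φ b))
    (h : ∀ j, j < n → φ (toV n (X ^ j * g)) + (c j * constantCoeff u ^ n) • e n n =
        toV n (X ^ j * u ^ (j + 2) * g') + lam n c' (X ^ j * u ^ (j + 2)) • e n n) :
    Isomorphic (mu n) (stdProduct n g c) (mu n) (stdProduct n g' c') := by
  refine ⟨φ, hmu, ?_⟩
  have hen : φ (e n n) = constantCoeff u ^ n • e n n := by
    rw [← toV_X_pow, hφ, mul_pow, toV_X_pow_mul, map_pow, toV_X_pow]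
  suffices hs : (stdProduct n g c).compr₂ φ.toLinearMap =
      (stdProduct n g' c').compl₁₂ φ.toLinearMap φ.toLinearMap from
    fun a b => LinearMap.congr_fun₂ hs a b
  refine ext_e fun i j _ _ => ?_
  simp only [LinearMap.compr₂_apply, LinearMap.compl₁₂_apply, LinearEquiv.coe_coe]
  rw [← toV_X_pow n (i + 1), ← toV_X_pow n (j + 1), hφ, hφ, pow_succ', pow_succ', pow_succ',
    pow_succ', mul_assoc X u, mul_assoc X u, stdProduct_toV hg, stdProduct_toV hg', ← pow_add,
    show u * (X * u) ^ i * (u * (X * u) ^ j) = X ^ (i + j) * u ^ (i + j + 2) by ring]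
  rcases Nat.lt_or_ge (i + j) n with hij | hij
  · rw [← h _ hij, map_add, map_smul, hen, smul_smul, lam_X_pow c hij]
  · have h1 : ∀ (y g : ℂ⟦X⟧) (c : ℕ → ℂ), constantCoeff g = 0 →
        toV n (X ^ (i + j) * y * g) = 0 ∧ lam n c (X ^ (i + j) * y) = 0 := by
      intro y g c hg
      have hd : X ^ n ∣ X ^ (i + j) * y := (pow_dvd_pow X hij).mul_right y
      exact ⟨toV_eq_zero (by rw [pow_succ]; exact mul_dvd_mul hd (X_dvd_iff.2 hg)),
        lam_eq_zero hd fun j h1 h2 => by omega⟩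
    have h2 := h1 1 g c hg
    rw [mul_one] at h2
    rw [h2.1, h2.2, (h1 _ g' c' hg').1, (h1 _ g' c' hg').2]
    simp

/-! ### The triangular action of substitutions on corrections -/

theorem X_dvd_pow_sub_one {u : ℂ⟦X⟧} {k : ℕ} (hu : X ^ k ∣ u - 1) (M : ℕ) : X ^ k ∣ u ^ M - 1 := by
  have := sub_dvd_pow_sub_pow u 1 M
  rw [one_pow] at this
  exact hu.trans this

/-- First-order expansion: u ≡ 1 modulo X replaces M u^(M-1) v by M v, and the error gains one power
of X. -/
theorem X_pow_dvd_add_pow_sub {k : ℕ} (hk : 1 ≤ k) {u v : ℂ⟦X⟧} (hu : X ∣ u - 1)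
    (hv : X ^ k ∣ v) (M : ℕ) : X ^ (k + 1) ∣ (u + v) ^ M - u ^ M - (M : ℂ⟦X⟧) * v := by
  induction M with
  | zero => simp
  | succ M ih =>
    have h1 : X ∣ u ^ M - 1 := by
      have := X_dvd_pow_sub_one (k := 1) (by rwa [pow_one]) M
      rwa [pow_one] at this
    have h2 : X ∣ v := (dvd_pow_self X (by omega)).trans hv
    have e1 : (u + v) ^ (M + 1) - u ^ (M + 1) - ((M + 1 : ℕ) : ℂ⟦X⟧) * v =
        ((u + v) ^ M - u ^ M - (M : ℂ⟦X⟧) * v) * (u + v) +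
          v * ((u ^ M - 1) + (M : ℂ⟦X⟧) * (u - 1) + (M : ℂ⟦X⟧) * v) := by
      push_cast
      ring
    rw [e1]
    refine dvd_add (ih.mul_right _) ?_
    rw [pow_succ]
    exact mul_dvd_mul hv (dvd_add (dvd_add h1 (hu.mul_left _)) (h2.mul_left _))

/-- The error of the first-order expansion has order j + k + 1 > J, where the functional vanishes,
so the dependence on v is exactly linear. -/
theorem lam_add_pow {n J : ℕ} {c : ℕ → ℂ} (hc : ∀ j, J < j → j < n → c j = 0) {j k : ℕ}
    (hk : 1 ≤ k) (hjk : J ≤ j + k) {u v : ℂ⟦X⟧} (hu : X ∣ u - 1) (hv : X ^ k ∣ v) (M : ℕ) :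
    lam n c (X ^ j * (u + v) ^ M) = lam n c (X ^ j * u ^ M) + M * lam n c (X ^ j * v) := by
  have h := lam_eq_zero (n := n) (c := c) (k := j + k + 1)
    (y := X ^ j * ((u + v) ^ M - u ^ M - (M : ℂ⟦X⟧) * v))
    (by rw [add_assoc, pow_add]; exact mul_dvd_mul_left _ (X_pow_dvd_add_pow_sub hk hu hv M))
    fun i hi hin => hc i (by omega) hin
  rw [show X ^ j * ((u + v) ^ M - u ^ M - (M : ℂ⟦X⟧) * v) =
    X ^ j * (u + v) ^ M - X ^ j * u ^ M - (M : ℂ) • (X ^ j * v) by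
      rw [smul_eq_C_mul, map_natCast]; ring, map_sub, map_sub, map_smul] at h
  rw [smul_eq_mul] at h
  linear_combination h

/-- Coefficients below the leading one can be prescribed by a substitution `X ↦ X u`. -/
theorem exists_unit_lam_eq {n J d : ℕ} (c τ : ℕ → ℂ) (ε : ℂ) (hJ : J < n) (hd : 1 ≤ d)
    (hdJ : d ≤ J) (hc : ∀ j, J < j → j < n → c j = 0) (h1 : J = d → 2 * c J ≠ ε)
    (h2 : d < J → c J ≠ 0) :
    ∃ u : ℂ⟦X⟧, X ^ d ∣ u - 1 ∧ ∀ j, j ≤ J - d →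
      lam n c (X ^ j * u ^ (j + 2)) = τ j + if j = 0 then ε * coeff d u else 0 := by
  suffices H : ∀ t, t ≤ J - d + 1 → ∃ u : ℂ⟦X⟧, X ^ d ∣ u - 1 ∧ ∀ j, j ≤ J - d → J - d < j + t →
      lam n c (X ^ j * u ^ (j + 2)) = τ j + if j = 0 then ε * coeff d u else 0 by
    obtain ⟨u, hu, h⟩ := H _ le_rfl
    exact ⟨u, hu, fun j hj => h j hj (by omega)⟩
  intro t
  induction t with
  | zero => exact fun _ => ⟨1, by simp, fun j h1 h2 => by omega⟩
  | succ t ih =>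
    intro ht
    obtain ⟨u, hu, h⟩ := ih (by omega)
    obtain ⟨i, hi⟩ : ∃ i, i + t + d = J := ⟨J - d - t, by omega⟩
    have hXu : X ∣ u - 1 := (dvd_pow_self X (by omega)).trans hu
    -- The pivot: the rate at which the equation at j = i changes with the coefficient of X^(d+t).
    -- For i = 0 and t = 0 the right side also moves, since it contains coeff d u.
    set D : ℂ := ((i + 2 : ℕ) : ℂ) * c J - if i = 0 ∧ t = 0 then ε else 0 with hD
    have hD0 : D ≠ 0 := by
      rw [hD]
      split_ifs with hit
      · have := h1 (by omega)
        rw [hit.1]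
        push_cast
        intro h0
        apply this
        linear_combination h0
      · rw [sub_zero]
        refine mul_ne_zero (by exact_mod_cast (by omega : i + 2 ≠ 0)) ?_
        rcases Nat.lt_or_ge d J with hlt | hge
        · exact h2 hlt
        · omega
    set a : ℂ := (τ i + (if i = 0 then ε * coeff d u else 0) - lam n c (X ^ i * u ^ (i + 2))) / D
    have ha : a * D = τ i + (if i = 0 then ε * coeff d u else 0) - lam n c (X ^ i * u ^ (i + 2)) :=
      div_mul_cancel₀ _ hD0
    have hv : X ^ (d + t) ∣ a • (X : ℂ⟦X⟧) ^ (d + t) := by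
      rw [smul_eq_C_mul]
      exact dvd_mul_left _ _
    -- The new term affects the entry i = J - d - t and none of the entries already treated.
    have hlam : ∀ j, j ≤ J - d → J - d < j + (t + 1) →
        lam n c (X ^ j * (u + a • X ^ (d + t)) ^ (j + 2)) = lam n c (X ^ j * u ^ (j + 2)) +
          if j = i then ((i + 2 : ℕ) : ℂ) * (a * c J) else 0 := by
      intro j hj1 hj2
      rw [lam_add_pow hc (by omega) (by omega) hXu hv, mul_smul_comm, map_smul, ← pow_add]
      split_ifs with hji
      · subst hji
        rw [lam_X_pow c (by omega), show j + (d + t) = J by omega, smul_eq_mul]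
      · rw [lam_eq_zero (dvd_refl _) fun l hl1 hl2 => hc l (by omega) hl2, smul_zero, mul_zero]
    refine ⟨u + a • X ^ (d + t), ?_, fun j hj1 hj2 => ?_⟩
    · rw [add_sub_right_comm]
      exact dvd_add hu ((pow_dvd_pow _ (by omega)).trans hv)
    rw [hlam j hj1 hj2]
    by_cases hji : j = i
    · subst hji
      rw [if_pos rfl, map_add, map_smul, coeff_X_pow]
      have ht0 : d = d + t ↔ t = 0 := by omega
      simp only [ht0]
      by_cases hj0 : j = 0 <;> by_cases ht00 : t = 0 <;>
        simp only [hj0, ht00, if_true, if_false, and_true, and_false,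
          smul_eq_mul, mul_one, mul_zero, add_zero, sub_zero] at ha hD ⊢ <;>
        linear_combination ha - a * hD
    · rw [if_neg hji, h j hj1 (by omega), if_neg (by omega), if_neg (by omega), add_zero]

theorem lam_X_pow_mul_pow {n J : ℕ} {c : ℕ → ℂ} (hc : ∀ j, J < j → j < n → c j = 0) {j : ℕ}
    (hJ : J ≤ j) (hj : j < n) {u : ℂ⟦X⟧} (M : ℕ) :
    lam n c (X ^ j * u ^ M) = constantCoeff u ^ M * c j := by
  rw [lam_X_pow_mul hj fun i hi hin => hc i (by omega) hin, map_pow]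

/-- The coefficients are determined by the leading one and by the prescribed ones. -/
theorem eq_of_lam_eq {n J d : ℕ} {c c' : ℕ → ℂ} {ε : ℂ} (hJ : J < n) (hd : 1 ≤ d)
    (hdJ : d ≤ J) (hc : ∀ j, J < j → j < n → c' j = 0)
    (h : (J = d ∧ 2 * c' J = ε) ∨
      ((J = d → 2 * c' J ≠ ε) ∧ (d < J → c' J ≠ 0) ∧ ∀ j, j ≤ J - d → c j = c' j))
    {u : ℂ⟦X⟧} (hu : X ^ d ∣ u - 1)
    (hrel : ∀ j, j < n →
      lam n c' (X ^ j * u ^ (j + 2)) = c j + if j = 0 then ε * coeff d u else 0) :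
    ∀ j, j < n → c j = c' j := by
  -- With u = 1 + X^k w, the entry J - k sees only the constant term of w, multiplied by the leading
  -- coefficient.
  have step : ∀ k, d ≤ k → k ≤ J → X ^ k ∣ u - 1 →
      ∃ w, u - 1 = X ^ k * w ∧
        (k = d → coeff d u = constantCoeff w) ∧ (d < k → coeff d u = 0) ∧
        lam n c' (X ^ (J - k) * u ^ (J - k + 2)) =
          c' (J - k) + ((J - k + 2 : ℕ) : ℂ) * (constantCoeff w * c' J) := by
    intro k hk1 hk2 hdvd
    obtain ⟨w, hw⟩ := hdvd
    have hu1 : u = 1 + X ^ k * w := by rw [← hw]; ring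
    refine ⟨w, hw, ?_, ?_, ?_⟩
    · rintro rfl
      rw [hu1, map_add, coeff_one, if_neg (by omega), zero_add,
        show coeff k (X ^ k * w) = coeff (0 + k) (X ^ k * w) by rw [zero_add], coeff_X_pow_mul]
      simp
    · intro hdk
      rw [hu1, map_add, coeff_one, if_neg (by omega), coeff_X_pow_mul', if_neg (by omega), add_zero]
    · rw [hu1, lam_add_pow hc (by omega) (by omega) (by simp) (dvd_mul_right _ _), ← mul_assoc,
        ← pow_add, one_pow, mul_one, lam_X_pow c' (by omega), Nat.sub_add_cancel hk2,
        lam_X_pow_mul hJ hc]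
  rcases h with ⟨rfl, hε⟩ | ⟨h1, h2, h3⟩
  -- Zero pivot: at j = 0 the change of the functional cancels against ε * coeff d u; for j > 0
  -- nothing changes.
  · intro j hj
    have hr := hrel j hj
    rcases Nat.eq_zero_or_pos j with rfl | hj0
    · obtain ⟨w, -, hw, -, hl⟩ := step J le_rfl le_rfl hu
      rw [Nat.sub_self] at hl
      rw [hl, hw rfl, if_pos rfl] at hr
      push_cast at hr
      linear_combination -hr + constantCoeff w * hε
    · rw [if_neg hj0.ne', add_zero] at hr
      rw [← hr, show u = 1 + (u - 1) by ring, lam_add_pow hc hd (by omega) (by simp) hu, one_pow, mul_one,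
        lam_X_pow c' hj, lam_eq_zero (k := j + J), mul_zero, add_zero]
      · rw [pow_add]
        exact mul_dvd_mul_left _ hu
      · exact fun i hi hin => hc i (by omega) hin
  -- Nonzero pivots: equality of the entries J - k kills the constant term of w, so u - 1 gains one
  -- power of X at a time until u acts trivially.
  · have H : ∀ k, d ≤ k → k ≤ J + 1 → X ^ k ∣ u - 1 := by
      intro k hk
      induction k, hk using Nat.le_induction with
      | base => exact fun _ => hu
      | succ k hk ih =>
        intro hkJ
        obtain ⟨w, hw, hwd, hwk, hl⟩ := step k hk (by omega) (ih (by omega))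
        rw [hrel _ (by omega), h3 _ (by omega), add_right_inj] at hl
        have hw0 : constantCoeff w = 0 := by
          rcases Nat.lt_or_ge d k with hlt | hge
          · rw [hwk hlt, mul_zero, ite_self] at hl
            have hne : ((J - k + 2 : ℕ) : ℂ) ≠ 0 := by exact_mod_cast (by omega : J - k + 2 ≠ 0)
            exact (mul_eq_zero.1 ((mul_eq_zero.1 hl.symm).resolve_left hne)).resolve_right
              (h2 (by omega))
          · have hkd : k = d := by omega
            subst hkd
            rw [hwd rfl] at hl
            rcases Nat.eq_zero_or_pos (J - k) with h0 | hpos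
            · rw [h0, if_pos rfl] at hl
              have : (2 * c' J - ε) * constantCoeff w = 0 := by
                push_cast at hl
                linear_combination -hl
              exact (mul_eq_zero.1 this).resolve_left (sub_ne_zero.2 (h1 (by omega)))
            · rw [if_neg hpos.ne'] at hl
              have hne : ((J - k + 2 : ℕ) : ℂ) ≠ 0 := by exact_mod_cast (by omega : J - k + 2 ≠ 0)
              exact (mul_eq_zero.1 ((mul_eq_zero.1 hl.symm).resolve_left hne)).resolve_right
                (h2 (by omega))
        rw [hw, pow_succ]
        exact mul_dvd_mul_left _ (X_dvd_iff.2 hw0)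
    have hfin := H (J + 1) (by omega) le_rfl
    intro j hj
    have hr := hrel j hj
    have hcd : coeff d u = 0 := by
      have := X_pow_dvd_iff.1 hfin d (by omega)
      rw [map_sub, coeff_one, if_neg (by omega), sub_zero] at this
      exact this
    rw [hcd, mul_zero, ite_self, add_zero] at hr
    rw [← hr]
    have h0 := lam_eq_zero (n := n) (c := c') (k := J + 1)
      ((X_dvd_pow_sub_one hfin (j + 2)).mul_left (X ^ j)) fun i hi hin => hc i (by omega) hin
    rw [mul_sub, mul_one, map_sub, lam_X_pow c' hj, sub_eq_zero] at h0
    exact h0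

/-! ### Roots of units in power series -/

/-- Successive approximation after scaling the constant term to 1; each step divides the leading
error by k, and a k-th root of the original constant term is restored at the end. -/
theorem exists_pow_sub_dvd {k : ℕ} (hk : 1 ≤ k) {v : ℂ⟦X⟧} (hv : constantCoeff v ≠ 0) (t : ℕ) :
    ∃ u : ℂ⟦X⟧, constantCoeff u ≠ 0 ∧ X ^ t ∣ u ^ k - v := by
  have H : ∀ v : ℂ⟦X⟧, constantCoeff v = 1 → ∀ t, ∃ u : ℂ⟦X⟧, X ∣ u - 1 ∧
      X ^ (t + 1) ∣ u ^ k - v := by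
    intro v hv t
    induction t with
    | zero => exact ⟨1, by simp, by simp [X_dvd_iff, hv]⟩
    | succ t ih =>
      obtain ⟨u, hu, w, hw⟩ := ih
      have hk0 : (k : ℂ) ≠ 0 := by exact_mod_cast (by omega : k ≠ 0)
      have hd := X_pow_dvd_add_pow_sub (k := t + 1) (by omega) hu
        (v := X ^ (t + 1) * C (-constantCoeff w / k)) (dvd_mul_right _ _) k
      refine ⟨u + X ^ (t + 1) * C (-constantCoeff w / k), ?_, ?_⟩
      · rw [add_sub_right_comm]
        exact dvd_add hu (((dvd_pow_self X (by omega)).mul_right _))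
      · have e1 : (u + X ^ (t + 1) * C (-constantCoeff w / k)) ^ k - v =
            ((u + X ^ (t + 1) * C (-constantCoeff w / k)) ^ k - u ^ k -
              (k : ℂ⟦X⟧) * (X ^ (t + 1) * C (-constantCoeff w / k))) +
              X ^ (t + 1) * (w + C ((k : ℂ) * (-constantCoeff w / k))) := by
          rw [map_mul, map_natCast]
          linear_combination hw
        rw [e1]
        refine dvd_add hd ?_
        rw [pow_succ]
        refine mul_dvd_mul_left _ (X_dvd_iff.2 ?_)
        rw [mul_div_cancel₀ _ hk0]
        simp
  obtain ⟨r, hr⟩ := IsAlgClosed.exists_pow_nat_eq (constantCoeff v) (by omega : 0 < k)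
  obtain ⟨u, hu, hd⟩ := H (C (constantCoeff v)⁻¹ * v) (by simp [hv]) t
  have hr0 : r ≠ 0 := by
    rintro rfl
    rw [zero_pow (by omega)] at hr
    exact hv hr.symm
  have hu1 : constantCoeff u = 1 := by
    have := X_dvd_iff.1 hu
    rw [map_sub, map_one, sub_eq_zero] at this
    exact this
  refine ⟨C r * u, by simp [hr0, hu1], ?_⟩
  have e1 : (C r * u) ^ k - v = C (constantCoeff v) * (u ^ k - C (constantCoeff v)⁻¹ * v) := by
    rw [mul_pow, ← map_pow, hr, mul_sub, ← mul_assoc, ← map_mul, mul_inv_cancel₀ hv, map_one,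
      one_mul]
  rw [e1]
  exact ((pow_dvd_pow X (Nat.le_succ t)).trans hd).mul_left _

/-- In u^m - 1 = (u - 1)(1 + u + ⋯ + u^(m-1)) the second factor has constant term m, hence is a
unit. -/
theorem X_pow_dvd_sub_one_of_pow {m t : ℕ} (hm : 1 ≤ m) {u : ℂ⟦X⟧} (hu : constantCoeff u = 1)
    (h : X ^ t ∣ u ^ m - 1) : X ^ t ∣ u - 1 := by
  rw [← mul_geom_sum] at h
  have hunit : IsUnit (∑ i ∈ Finset.range m, u ^ i) := by
    rw [isUnit_iff_constantCoeff]
    simpa [hu] using by omega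
  exact (hunit.dvd_mul_right).1 h

/-! ### Normal forms of the square of e_1 and their stabilisers -/

/-- The normal forms of `e_1 ⋆ e_1` modulo `e_n` without `e_1`-component. -/
noncomputable def lead (α ε : ℂ) (s : ℕ) : ℂ⟦X⟧ := C α * X ^ 2 + C ε * X ^ s

theorem lead_eq (α ε : ℂ) {s : ℕ} (hs : 2 ≤ s) :
    lead α ε s = X ^ 2 * (C α + C ε * X ^ (s - 2)) := by
  obtain ⟨k, rfl⟩ := Nat.exists_eq_add_of_le' hs
  rw [lead, Nat.add_sub_cancel]
  ring

theorem X_sq_dvd_lead (α ε : ℂ) {s : ℕ} (hs : 2 ≤ s) : X ^ 2 ∣ lead α ε s := by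
  rw [lead_eq α ε hs]
  exact dvd_mul_right _ _

theorem constantCoeff_lead (α ε : ℂ) {s : ℕ} (hs : 2 ≤ s) : constantCoeff (lead α ε s) = 0 := by
  rw [lead_eq α ε hs]
  simp

theorem coeff_one_lead (α ε : ℂ) {s : ℕ} (hs : 2 ≤ s) : coeff 1 (lead α ε s) = 0 :=
  X_pow_dvd_iff.1 (X_sq_dvd_lead α ε hs) 1 (by omega)

theorem map_toV_lead {n : ℕ} {φ : (Fin n → ℂ) ≃ₗ[ℂ] (Fin n → ℂ)} {u : ℂ⟦X⟧}
    (hφ : ∀ k, φ (toV n (X ^ k)) = toV n ((X * u) ^ k)) (j : ℕ) (α ε : ℂ) (s : ℕ) :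
    φ (toV n (X ^ j * lead α ε s)) =
      toV n (C α * (X * u) ^ (j + 2) + C ε * (X * u) ^ (j + s)) := by
  have h : X ^ j * lead α ε s = α • X ^ (j + 2) + ε • X ^ (j + s) := by
    rw [lead, smul_eq_C_mul, smul_eq_C_mul]
    ring
  rw [h, map_add, map_add, map_smul, map_smul, map_smul, map_smul, hφ, hφ, ← smul_eq_C_mul,
    ← smul_eq_C_mul, map_add, map_smul, map_smul]

theorem dvd_of_toV_add {n : ℕ} {a b : ℂ⟦X⟧} (ha : constantCoeff a = 0) (hb : constantCoeff b = 0)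
    {r r' : ℂ} (h : toV n a + r • e n n = toV n b + r' • e n n) : X ^ n ∣ a - b := by
  rw [X_pow_dvd_iff]
  intro m hm
  rcases Nat.eq_zero_or_pos m with rfl | hm0
  · simp [ha, hb]
  · have := congrFun h ⟨m - 1, by omega⟩
    simp only [Pi.add_apply, toV_apply, Pi.smul_apply, e, Nat.sub_add_cancel hm0, hm.ne, if_false,
      smul_zero, add_zero] at this
    rw [map_sub, this, sub_self]

theorem smul_e_injective {n : ℕ} (hn : 1 ≤ n) {r r' : ℂ} (h : r • e n n = r' • e n n) :
    r = r' := by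
  have := congrFun h ⟨n - 1, by omega⟩
  simpa [e, Nat.sub_add_cancel hn] using this

theorem isUnit_of_constantCoeff {u : ℂ⟦X⟧} (hu : constantCoeff u ≠ 0) : IsUnit u :=
  isUnit_iff_constantCoeff.2 (isUnit_iff_ne_zero.2 hu)

/-- What an isomorphism says about the normal forms of `e_1 ⋆ e_1`. -/
theorem lead_dvd_of_isomorphic {n : ℕ} {α ε α' ε' : ℂ} {s s' : ℕ} (hs : 3 ≤ s)
    (hs' : 3 ≤ s') (hn : 3 ≤ n) {c c' : ℕ → ℂ}
    (h : Isomorphic (mu n) (stdProduct n (lead α ε s) c)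
      (mu n) (stdProduct n (lead α' ε' s') c')) :
    α = α' ∧ ∃ u : ℂ⟦X⟧, constantCoeff u ≠ 0 ∧
      X ^ (n - 2) ∣ C ε * X ^ (s - 2) * u ^ (s - 2) - C ε' * X ^ (s' - 2) ∧
      ∀ j, j < n → toV n (C α * (X * u) ^ (j + 2) + C ε * (X * u) ^ (j + s)) +
        (c j * constantCoeff u ^ n) • e n n =
        toV n (X ^ j * u ^ (j + 2) * lead α' ε' s') +
          lam n c' (X ^ j * u ^ (j + 2)) • e n n := by
  obtain ⟨φ, u, hu, hφ, hrel⟩ := exists_unit_of_isomorphic (by omega)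
    (constantCoeff_lead α ε (by omega)) (constantCoeff_lead α' ε' (by omega)) h
  simp only [map_toV_lead hφ] at hrel
  have h0 := dvd_of_toV_add (by simp [show s ≠ 0 by omega])
    (by simp [constantCoeff_lead α' ε' (by omega : 2 ≤ s')]) (hrel 0 (by omega))
  obtain ⟨m, rfl⟩ := Nat.exists_eq_add_of_le' (by omega : 2 ≤ n)
  obtain ⟨k, rfl⟩ := Nat.exists_eq_add_of_le' (by omega : 2 ≤ s)
  have e1 : C α * (X * u) ^ (0 + 2) + C ε * (X * u) ^ (0 + (k + 2)) -
      X ^ 0 * u ^ (0 + 2) * lead α' ε' s' =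
      X ^ 2 * (u ^ 2 * ((C α - C α') + (C ε * X ^ k * u ^ k - C ε' * X ^ (s' - 2)))) := by
    rw [lead_eq _ _ (by omega)]
    ring
  -- Cancelling X² and the unit u² leaves a congruence modulo X^(n-2) whose constant term compares α
  -- with α'.
  rw [e1, pow_add, mul_comm (X ^ m)] at h0
  have h2 := (mul_dvd_mul_iff_left (pow_ne_zero 2 X_ne_zero)).1 h0
  have hu2 := (isUnit_of_constantCoeff hu).pow 2
  rw [hu2.dvd_mul_left] at h2
  have hα : α = α' := by
    have := X_pow_dvd_iff.1 h2 0 (by omega)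
    simpa [show k ≠ 0 by omega, show s' - 2 ≠ 0 by omega, sub_eq_zero] using this
  refine ⟨hα, u, hu, ?_, hrel⟩
  rw [hα, sub_self, zero_add] at h2
  simpa using h2

/-- The substitution carries α X^(j+2) to X^j u^(j+2) · α X² exactly, so no condition on u arises
and only the corrections are compared. -/
theorem rel_of_isomorphic_zero {n : ℕ} {α α' : ℂ} (hn : 3 ≤ n) {c c' : ℕ → ℂ}
    (h : Isomorphic (mu n) (stdProduct n (lead α 0 3) c) (mu n) (stdProduct n (lead α' 0 3) c')) :
    α = α' ∧ ∃ u : ℂ⟦X⟧, constantCoeff u ≠ 0 ∧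
      ∀ j, j < n → lam n c' (X ^ j * u ^ (j + 2)) = c j * constantCoeff u ^ n := by
  obtain ⟨rfl, u, hu, -, hrel⟩ := lead_dvd_of_isomorphic le_rfl le_rfl hn h
  refine ⟨rfl, u, hu, fun j hj => ?_⟩
  have := hrel j hj
  have e1 : C α * (X * u) ^ (j + 2) + C 0 * (X * u) ^ (j + 3) =
      X ^ j * u ^ (j + 2) * lead α 0 3 := by
    rw [lead, map_zero]
    ring
  rw [e1] at this
  exact (smul_e_injective (by omega) (add_left_cancel this)).symm

theorem isomorphic_zero {n : ℕ} {α : ℂ} {c c' : ℕ → ℂ} {u : ℂ⟦X⟧} (hu : constantCoeff u ≠ 0)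
    (h : ∀ j, j < n → lam n c' (X ^ j * u ^ (j + 2)) = c j * constantCoeff u ^ n) :
    Isomorphic (mu n) (stdProduct n (lead α 0 3) c) (mu n) (stdProduct n (lead α 0 3) c') := by
  obtain ⟨φ, hφ, hmu⟩ := exists_aut n hu
  refine isomorphic_of_aut (constantCoeff_lead _ _ (by omega)) (constantCoeff_lead _ _ (by omega))
    hφ hmu fun j hj => ?_
  rw [map_toV_lead hφ, h j hj]
  congr 2
  rw [lead, map_zero]
  ring

theorem not_isomorphic_zero_one {n : ℕ} {α α' : ℂ} {s : ℕ} (hs : 3 ≤ s) (hsn : s ≤ n - 1)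
    {c c' : ℕ → ℂ} : ¬ Isomorphic (mu n) (stdProduct n (lead α 0 3) c)
      (mu n) (stdProduct n (lead α' 1 s) c') := by
  intro h
  obtain ⟨-, u, -, hd, -⟩ := lead_dvd_of_isomorphic le_rfl hs (by omega) h
  have := X_pow_dvd_iff.1 hd (s - 2) (by omega)
  simp at this

/-- Since (ζ u)^(s-2) is 1 up to order n - s, the substitution preserves the normal form up to X^n.
The mismatch has order n + j, hence is visible only for j = 0. -/
theorem toV_lead_one {n s j : ℕ} {α ζ : ℂ} {u : ℂ⟦X⟧} (hs : 3 ≤ s) (hsn : s ≤ n - 1)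
    (hζ : ζ ^ (s - 2) = 1) (hu : X ^ (n - s) ∣ u - 1) :
    toV n (C α * (X * (C ζ * u)) ^ (j + 2) + C 1 * (X * (C ζ * u)) ^ (j + s)) =
      toV n (X ^ j * (C ζ * u) ^ (j + 2) * lead α 1 s) +
        (ζ ^ (j + 2) * if j = 0 then ((s : ℂ) - 2) * coeff (n - s) u else 0) • e n n := by
  obtain ⟨w, hw⟩ := hu
  obtain ⟨v, hv⟩ := X_pow_dvd_add_pow_sub (k := n - s) (by omega) (u := 1) (v := u - 1) (by simp)
    ⟨w, hw⟩ (s - 2)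
  have hpow : (C ζ * u) ^ (s - 2) = 1 + X ^ (n - s) * (((s - 2 : ℕ) : ℂ⟦X⟧) * w + X * v) := by
    rw [mul_pow, ← map_pow, hζ, map_one, one_mul]
    rw [add_sub_cancel, one_pow, hw, pow_succ] at hv
    linear_combination hv
  have hcoeff : coeff (n - s) u = constantCoeff w := by
    have hu1 : u = 1 + X ^ (n - s) * w := by rw [← hw]; ring
    rw [hu1, map_add, coeff_one, if_neg (by omega), zero_add,
      show coeff (n - s) (X ^ (n - s) * w) = coeff (0 + (n - s)) (X ^ (n - s) * w) by
        rw [zero_add], coeff_X_pow_mul]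
    simp
  have e1 : C α * (X * (C ζ * u)) ^ (j + 2) + C 1 * (X * (C ζ * u)) ^ (j + s) =
      X ^ j * (C ζ * u) ^ (j + 2) * lead α 1 s +
        X ^ n * (X ^ j * ((C ζ * u) ^ (j + 2) * (((s - 2 : ℕ) : ℂ⟦X⟧) * w + X * v))) := by
    rw [show j + s = (j + 2) + (s - 2) by omega, pow_add (X * (C ζ * u)) (j + 2) (s - 2),
      mul_pow X _ (s - 2), hpow, lead_eq _ _ (by omega)]
    have : (X : ℂ⟦X⟧) ^ n = X ^ 2 * X ^ (s - 2) * X ^ (n - s) := by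
      rw [← pow_add, ← pow_add]
      congr 1
      omega
    rw [this, map_one]
    ring
  rw [e1, map_add, toV_X_pow_mul, hcoeff]
  congr 2
  have hw0 : constantCoeff u = 1 := by
    have h : X ∣ u - 1 := hw ▸ ((dvd_pow_self X (by omega)).mul_right w)
    have := X_dvd_iff.1 h
    rwa [map_sub, map_one, sub_eq_zero] at this
  rcases Nat.eq_zero_or_pos j with rfl | hj
  · have hcast : ((s - 2 : ℕ) : ℂ) = (s : ℂ) - 2 := by
      rw [Nat.cast_sub (by omega)]
      rfl
    simp [hw0, hcast]
  · simp [hj.ne']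

/-- Comparing lowest terms gives s = s'. Cancelling X^(s-2) leaves u^(s-2) ≡ 1 modulo X^(n-s), so u
is a root of unity ζ times a series congruent to 1; the mismatch from `toV_lead_one` yields the term
at j = 0. -/
theorem rel_of_isomorphic_one {n s s' : ℕ} {α α' : ℂ} (hs : 3 ≤ s) (hsn : s ≤ n - 1)
    (hs' : 3 ≤ s') (hsn' : s' ≤ n - 1) {c c' : ℕ → ℂ} (hc : c (n - 1) = 0)
    (h : Isomorphic (mu n) (stdProduct n (lead α 1 s) c) (mu n) (stdProduct n (lead α' 1 s') c')) :
    α = α' ∧ s = s' ∧ ∃ (ζ : ℂ) (u : ℂ⟦X⟧), ζ ^ (s - 2) = 1 ∧ X ^ (n - s) ∣ u - 1 ∧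
      ∀ j, j < n → lam n c' (X ^ j * u ^ (j + 2)) =
        ζ ^ (n - 2 - j) * c j + if j = 0 then ((s : ℂ) - 2) * coeff (n - s) u else 0 := by
  obtain ⟨rfl, u, hu, hd, hrel⟩ := lead_dvd_of_isomorphic hs hs' (by omega) h
  simp only [map_one, one_mul] at hd
  have hss : s = s' := by
    rcases lt_trichotomy s s' with hlt | heq | hgt
    · have := X_pow_dvd_iff.1 hd (s - 2) (by omega)
      rw [map_sub, coeff_X_pow, if_neg (by omega), sub_zero,
        show coeff (s - 2) (X ^ (s - 2) * u ^ (s - 2)) =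
          coeff (0 + (s - 2)) (X ^ (s - 2) * u ^ (s - 2)) by rw [zero_add], coeff_X_pow_mul,
        coeff_zero_eq_constantCoeff_apply, map_pow] at this
      exact absurd this (pow_ne_zero _ hu)
    · exact heq
    · have := X_pow_dvd_iff.1 hd (s' - 2) (by omega)
      rw [map_sub, coeff_X_pow, if_pos rfl, coeff_X_pow_mul', if_neg (by omega)] at this
      simp at this
  subst hss
  have e1 : X ^ (s - 2) * u ^ (s - 2) - X ^ (s - 2) = X ^ (s - 2) * (u ^ (s - 2) - 1) := by ring
  rw [e1, show n - 2 = (s - 2) + (n - s) by omega, pow_add,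
    mul_dvd_mul_iff_left (pow_ne_zero _ X_ne_zero)] at hd
  obtain ⟨ζ, hζ⟩ : ∃ ζ, ζ = constantCoeff u := ⟨_, rfl⟩
  have hζ0 : ζ ≠ 0 := hζ ▸ hu
  have hζ1 : ζ ^ (s - 2) = 1 := by
    have := X_pow_dvd_iff.1 hd 0 (by omega)
    simpa [← hζ, sub_eq_zero] using this
  obtain ⟨v, hv⟩ : ∃ v, v = C ζ⁻¹ * u := ⟨_, rfl⟩
  have huv : u = C ζ * v := by
    rw [hv, ← mul_assoc, ← map_mul, mul_inv_cancel₀ hζ0, map_one, one_mul]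
  have hv1 : constantCoeff v = 1 := by
    rw [hv]
    simp [← hζ, hζ0]
  rw [huv, mul_pow, ← map_pow, hζ1, map_one, one_mul] at hd
  have hvd := X_pow_dvd_sub_one_of_pow (by omega) hv1 hd
  refine ⟨rfl, rfl, ζ, v, hζ1, hvd, fun j hj => ?_⟩
  have hr := hrel j hj
  rw [huv, toV_lead_one hs hsn hζ1 hvd, add_assoc, ← add_smul] at hr
  have hr := smul_e_injective (by omega) (add_left_cancel hr)
  have e2 : X ^ j * (C ζ * v) ^ (j + 2) = ζ ^ (j + 2) • (X ^ j * v ^ (j + 2)) := by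
    rw [smul_eq_C_mul, map_pow]
    ring
  rw [e2, map_smul, smul_eq_mul, map_mul, hv1, mul_one, constantCoeff_C] at hr
  apply mul_left_cancel₀ (pow_ne_zero (j + 2) hζ0)
  rw [← hr]
  -- For j = n - 1 the natural subtraction n - 2 - j truncates to 0; this is harmless because c (n -
  -- 1) = 0.
  rcases Nat.lt_or_ge (n - 2) j with hjn | hjn
  · rw [show j = n - 1 by omega, hc]
    ring
  · have : ζ ^ n = ζ ^ (j + 2) * ζ ^ (n - 2 - j) := by
      rw [← pow_add]
      congr 1
      omega
    rw [this]
    ring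

theorem isomorphic_one {n s : ℕ} {α ζ : ℂ} (hs : 3 ≤ s) (hsn : s ≤ n - 1) {c c' : ℕ → ℂ}
    (hc : c (n - 1) = 0) {u : ℂ⟦X⟧} (hζ : ζ ^ (s - 2) = 1) (hu : X ^ (n - s) ∣ u - 1)
    (h : ∀ j, j < n → lam n c' (X ^ j * u ^ (j + 2)) =
        ζ ^ (n - 2 - j) * c j + if j = 0 then ((s : ℂ) - 2) * coeff (n - s) u else 0) :
    Isomorphic (mu n) (stdProduct n (lead α 1 s) c) (mu n) (stdProduct n (lead α 1 s) c') := by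
  have hζ0 : ζ ≠ 0 := by
    rintro rfl
    rw [zero_pow (by omega)] at hζ
    exact zero_ne_one hζ
  have hu1 : constantCoeff u = 1 := by
    have := X_pow_dvd_iff.1 hu 0 (by omega)
    simpa [sub_eq_zero] using this
  obtain ⟨φ, hφ, hmu⟩ := exists_aut n (u := C ζ * u) (by simp [hζ0, hu1])
  refine isomorphic_of_aut (constantCoeff_lead _ _ (by omega)) (constantCoeff_lead _ _ (by omega))
    hφ hmu fun j hj => ?_
  rw [map_toV_lead hφ, toV_lead_one hs hsn hζ hu, add_assoc, ← add_smul]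
  congr 2
  have e2 : X ^ j * (C ζ * u) ^ (j + 2) = ζ ^ (j + 2) • (X ^ j * u ^ (j + 2)) := by
    rw [smul_eq_C_mul, map_pow]
    ring
  rw [e2, map_smul, smul_eq_mul, map_mul, hu1, mul_one, constantCoeff_C, h j hj]
  rcases Nat.lt_or_ge (n - 2) j with hjn | hjn
  · rw [show j = n - 1 by omega, hc]
    ring
  · have : ζ ^ n = ζ ^ (j + 2) * ζ ^ (n - 2 - j) := by
      rw [← pow_add]
      congr 1
      omega
    rw [this]
    ring

theorem not_isomorphic_X_lead {n : ℕ} (hn : 2 ≤ n) {α ε : ℂ} {s : ℕ} (hs : 2 ≤ s)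
    {c c' : ℕ → ℂ} :
    ¬ Isomorphic (mu n) (stdProduct n X c) (mu n) (stdProduct n (lead α ε s) c') := by
  intro h
  obtain ⟨φ, u, hu, hφ, hrel⟩ := exists_unit_of_isomorphic (by omega) (by simp)
    (constantCoeff_lead α ε hs) h
  have h0 := hrel 0 (by omega)
  rw [pow_zero, one_mul, show φ (toV n X) = toV n (X * u) by simpa using hφ 1] at h0
  have h1 := dvd_of_toV_add (by simp) (by simp [constantCoeff_lead α ε hs]) h0
  have h2 := X_pow_dvd_iff.1 h1 1 (by omega)
  have h3 := X_pow_dvd_iff.1 ((X_sq_dvd_lead α ε hs).mul_left (1 * u ^ (0 + 2))) 1 (by omega)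
  rw [map_sub, h3, sub_zero, show coeff 1 (X * u) = coeff (0 + 1) (X * u) by rfl,
    coeff_succ_X_mul] at h2
  exact hu (by simpa using h2)

/-- Preserving X modulo e_n forces u ≡ 1 modulo X^(n-1), which cannot affect entries with j ≥ 1. The
entry j = 0 can still move; in A1 it is normalised to 0. -/
theorem eq_of_isomorphic_X {n : ℕ} (hn : 2 ≤ n) {c c' : ℕ → ℂ}
    (h : Isomorphic (mu n) (stdProduct n X c) (mu n) (stdProduct n X c')) :
    ∀ j, 1 ≤ j → j < n → c j = c' j := by
  obtain ⟨φ, u, hu, hφ, hrel⟩ := exists_unit_of_isomorphic (by omega) (by simp) (by simp) h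
  simp only [← pow_succ, hφ] at hrel
  have h0 := dvd_of_toV_add (by simp) (by simp) (hrel 0 (by omega))
  obtain ⟨m, rfl⟩ := Nat.exists_eq_add_of_le' (by omega : 1 ≤ n)
  rw [show (X * u) ^ (0 + 1) - X ^ 0 * u ^ (0 + 2) * X = X * (-u * (u - 1)) by ring, pow_succ',
    mul_dvd_mul_iff_left X_ne_zero, (isUnit_of_constantCoeff hu).neg.dvd_mul_left] at h0
  have hu1 : constantCoeff u = 1 := by
    have := X_pow_dvd_iff.1 h0 0 (by omega)
    simpa [sub_eq_zero] using this
  intro j hj hjn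
  have hr := hrel j hjn
  have e1 : toV (m + 1) ((X * u) ^ (j + 1)) = toV (m + 1) (X ^ j * u ^ (j + 2) * X) := by
    apply toV_eq_of_dvd
    rw [show (X * u) ^ (j + 1) - X ^ j * u ^ (j + 2) * X =
      (u - 1) * X ^ (j + 1) * (-u ^ (j + 1)) by ring]
    refine Dvd.dvd.mul_right ?_ _
    rw [show m + 1 + 1 = m + 2 by rfl, pow_add]
    exact mul_dvd_mul h0 (pow_dvd_pow _ (by omega))
  rw [e1] at hr
  have hr := smul_e_injective (by omega) (add_left_cancel hr)
  rw [hu1, one_pow, mul_one] at hr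
  have h2 := lam_eq_zero (n := m + 1) (c := c') (k := m + 1) (y := X ^ j * (u ^ (j + 2) - 1))
    (by
      rw [pow_succ']
      exact mul_dvd_mul (dvd_pow_self X (by omega)) (X_dvd_pow_sub_one h0 _))
    fun i h1 h2 => by omega
  rw [mul_sub, mul_one, map_sub, lam_X_pow c' hjn, sub_eq_zero] at h2
  rw [hr, h2]

/-! ### The listed algebras in standard form -/

theorem e_eq_zero {n k : ℕ} (h : n < k) : e n k = 0 := by
  rw [← toV_X_pow]
  exact toV_eq_zero (pow_dvd_pow _ h)

theorem toV_X_pow_mul_lead (n j : ℕ) (α ε : ℂ) (s : ℕ) :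
    toV n (X ^ j * lead α ε s) = α • e n (j + 2) + ε • e n (j + s) := by
  have h : X ^ j * lead α ε s = α • X ^ (j + 2) + ε • X ^ (j + s) := by
    rw [lead, smul_eq_C_mul, smul_eq_C_mul]
    ring
  rw [h, map_add, map_smul, map_smul, toV_X_pow, toV_X_pow]

/-- The corrections `c_j` of the algebra `A1`. -/
noncomputable def corrA1 (n : ℕ) (β : ℕ → ℂ) (j : ℕ) : ℂ :=
  if j = 0 then 0 else if j + 2 ≤ n then β (j + 1) else -1

theorem star_A1 {n : ℕ} (hn : 2 ≤ n) (β : ℕ → ℂ) :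
    (Label.A1 β).star n = stdProduct n X (corrA1 n β) := by
  refine stdProduct_congr (fun j hj => ?_) fun m hm => ?_
  · rw [← pow_succ, toV_X_pow]
    simp only [Label.value, corrA1]
    rcases Nat.eq_zero_or_pos j with rfl | hj0
    · simp
    · rw [if_neg (c := j + 2 = 2) (by omega), if_neg hj0.ne']
      split_ifs
      · rfl
      · rw [show j + 1 = n by omega]
        simp
  · simp only [Label.value]
    rw [if_neg (by omega), if_neg (by omega)]

theorem star_A2 (n : ℕ) (α β : ℂ) :
    (Label.A2 α β).star n =
      stdProduct n (lead α 0 3) (fun j => if j + 2 = n then β - α else 0) := by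
  refine stdProduct_congr (fun j hj => ?_) fun m hm => ?_
  · rw [toV_X_pow_mul_lead]
    simp only [Label.value]
    rcases lt_trichotomy (j + 2) n with h | h | h
    · rw [if_pos (by omega), if_neg h.ne]
      simp
    · rw [if_neg (by omega), if_pos h, if_pos h, h]
      module
    · rw [if_neg (by omega), if_neg (by omega), if_neg (by omega), e_eq_zero h]
      simp
  · simp only [Label.value]
    rw [if_neg (by omega), if_neg (by omega)]

theorem star_A3 {n r : ℕ} (hr : 2 ≤ r) (α : ℂ) :
    (Label.A3 r α).star n =
      stdProduct n (lead α 0 3) (fun j => if j + 1 + r = n then 1 else 0) := by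
  refine stdProduct_congr (fun j hj => ?_) fun m hm => ?_
  · rw [toV_X_pow_mul_lead]
    simp only [Label.value]
    by_cases h : j + 1 + r = n
    · rw [if_pos (by omega), if_pos h]
      simp
    · rw [if_neg (by omega), if_neg h]
      split_ifs with h2
      · simp
      · rw [e_eq_zero (by omega)]
        simp
  · simp only [Label.value]
    rw [if_neg (by omega), if_neg (by omega)]

/-- The corrections `c_j` of the algebra `(12)_s(α, β)`. -/
noncomputable def corr (n s : ℕ) (α : ℂ) (β : ℕ → ℂ) (j : ℕ) : ℂ :=
  if j + 2 ≤ n then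
    β (j + 1) - (if j + 2 = n then α else 0) - (if j + s = n then 1 else 0)
  else 0

theorem ofSum_twelve {n s : ℕ} (hs : 3 ≤ s) (α : ℂ) (β : ℕ → ℂ) :
    ofSum n (twelve n s α β) = stdProduct n (lead α 1 s) (corr n s α β) := by
  refine stdProduct_congr (fun j hj => ?_) fun m hm => ?_
  · rw [toV_X_pow_mul_lead, twelve, corr]
    by_cases h : j + 2 ≤ n
    · rw [if_pos h, if_pos h, show s + (j + 2) - 2 = j + s by omega,
        show j + 2 - 1 = j + 1 by omega]
      have h1 : (if j + 2 + 1 ≤ n then α • e n (j + 2) else 0) =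
          α • e n (j + 2) - (if j + 2 = n then α else 0) • e n n := by
        split_ifs with ha hb hb
        · omega
        · simp
        · rw [hb, sub_self]
        · omega
      have h2 : (if j + 2 + s ≤ n + 1 then e n (j + s) else 0) =
          e n (j + s) - (if j + s = n then (1 : ℂ) else 0) • e n n := by
        split_ifs with ha hb hb
        · omega
        · simp
        · rw [hb, one_smul, sub_self]
        · rw [e_eq_zero (by omega)]
          simp
      rw [h1, h2]
      module
    · rw [if_neg h, if_neg h, e_eq_zero (by omega), e_eq_zero (by omega)]
      simp
  · rw [twelve, if_neg (by omega)]

/-! ### Rigidity of normal forms of corrections -/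

/-- Normal forms of the corrections for fixed `s`, with `J` the index of the leading one. -/
structure IsNormal (n s : ℕ) (c : ℕ → ℂ) (J : ℕ) : Prop where
  three_le : 3 ≤ s
  le : s ≤ n - 1
  le_lead : n - s ≤ J
  lead_le : J + 2 ≤ n
  zero : ∀ j, J < j → j < n → c j = 0
  ne_zero : n - s < J → c J ≠ 0
  low : (J = n - s ∧ 2 * c J = (s : ℂ) - 2) ∨
    ((J = n - s → 2 * c J ≠ (s : ℂ) - 2) ∧
      ∀ j, j ≤ J - (n - s) → c j = if j + s = n then -1 else 0)

theorem IsNormal.last {n s J : ℕ} {c : ℕ → ℂ} (h : IsNormal n s c J) : c (n - 1) = 0 :=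
  h.zero _ (by have := h.lead_le; omega) (by have := h.lead_le; omega)

/-- From the leading index on, entries are only scaled by powers of ζ, so J is invariant. At J = n -
s the scale is ζ^(s-2) = 1, so the leading entry is invariant too, and with it the vanishing of the
pivot. Below, `eq_of_lam_eq` is applied to the corrections scaled by ζ; the prescribed entry -1 has
weight s - 2 and does not see ζ. -/
theorem IsNormal.of_isomorphic {n s s' J J' : ℕ} {α α' : ℂ} {c c' : ℕ → ℂ}
    (hc : IsNormal n s c J) (hc' : IsNormal n s' c' J')
    (h : Isomorphic (mu n) (stdProduct n (lead α 1 s) c) (mu n) (stdProduct n (lead α' 1 s') c')) :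
    α = α' ∧ s = s' ∧ J = J' ∧ (J = n - s → c J = c' J) ∧
      ∃ ζ : ℂ, ζ ^ (s - 2) = 1 ∧ ∀ j, j + 2 ≤ n → c' j = ζ ^ (n - 2 - j) * c j := by
  obtain ⟨rfl, rfl, ζ, u, hζ, hu, hrel⟩ :=
    rel_of_isomorphic_one hc.three_le hc.le hc'.three_le hc'.le hc.last h
  have h3 := hc.three_le
  have hsn := hc.le
  have hζ0 : ζ ≠ 0 := by
    rintro rfl
    rw [zero_pow (by omega)] at hζ
    exact zero_ne_one hζ
  have hu1 : constantCoeff u = 1 := by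
    have := X_pow_dvd_iff.1 hu 0 (by omega)
    simpa [sub_eq_zero] using this
  have htop : ∀ j, J' ≤ j → j < n → ζ ^ (n - 2 - j) * c j = c' j := by
    intro j hj hjn
    have h1 := hrel j hjn
    have h2 := hc'.le_lead
    rw [lam_X_pow_mul_pow hc'.zero hj hjn, hu1, one_pow, one_mul, if_neg (by omega), add_zero] at h1
    exact h1.symm
  have hJ : J = J' := by
    have h1 := hc.lead_le
    have h2 := hc'.lead_le
    have h4 := hc.le_lead
    have h5 := hc'.le_lead
    rcases lt_trichotomy J J' with hlt | heq | hgt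
    · have := htop J' le_rfl (by omega)
      rw [hc.zero J' hlt (by omega), mul_zero] at this
      exact absurd this.symm (hc'.ne_zero (by omega))
    · exact heq
    · have := htop J hgt.le (by omega)
      rw [hc'.zero J hgt (by omega)] at this
      exact absurd ((mul_eq_zero.1 this).resolve_left (pow_ne_zero _ hζ0))
        (hc.ne_zero (by omega))
  subst hJ
  have hJd : J = n - s → c J = c' J := by
    intro hJ
    have := htop J le_rfl (by omega)
    rwa [show n - 2 - J = s - 2 by omega, hζ, one_mul] at this
  refine ⟨rfl, rfl, rfl, hJd, ζ, hζ, fun j hj => ?_⟩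
  have hlow : (J = n - s ∧ 2 * c' J = (s : ℂ) - 2) ∨
      ((J = n - s → 2 * c' J ≠ (s : ℂ) - 2) ∧ (n - s < J → c' J ≠ 0) ∧
        ∀ j, j ≤ J - (n - s) → ζ ^ (n - 2 - j) * c j = c' j) := by
    rcases hc'.low with h1 | ⟨h1, h2⟩
    · exact Or.inl h1
    · refine Or.inr ⟨h1, hc'.ne_zero, fun j hj => ?_⟩
      rcases hc.low with ⟨h4, h5⟩ | ⟨h4, h5⟩
      · exact absurd (hJd h4 ▸ h5) (h1 h4)
      · rw [h2 j hj, h5 j hj]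
        split_ifs with hjs
        · rw [show n - 2 - j = s - 2 by omega, hζ, one_mul]
        · rw [mul_zero]
  have := eq_of_lam_eq (c := fun j => ζ ^ (n - 2 - j) * c j) (by have := hc.lead_le; omega)
    (by omega) hc.le_lead hc'.zero hlow hu hrel j (by omega)
  exact this.symm

theorem isomorphic_of_root {n s : ℕ} {α ζ : ℂ} {c c' : ℕ → ℂ} (hs : 3 ≤ s) (hsn : s ≤ n - 1)
    (hc : c (n - 1) = 0) (hc' : c' (n - 1) = 0) (hζ : ζ ^ (s - 2) = 1)
    (h : ∀ j, j + 2 ≤ n → c' j = ζ ^ (n - 2 - j) * c j) :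
    Isomorphic (mu n) (stdProduct n (lead α 1 s) c) (mu n) (stdProduct n (lead α 1 s) c') := by
  refine isomorphic_one hs hsn hc (u := 1) hζ (by simp) fun j hj => ?_
  rw [one_pow, mul_one, lam_X_pow _ hj, coeff_one, if_neg (c := n - s = 0) (by omega), mul_zero,
    ite_self, add_zero]
  rcases Nat.lt_or_ge (n - 2) j with hjn | hjn
  · rw [show j = n - 1 by omega, hc, hc', mul_zero]
  · exact h j (by omega)

/-- Corrections and parameters differ by α in weight 0 and by 1 in weight s - 2; neither shift is
moved by ζ. -/
theorem corr_root_iff {n s : ℕ} (hs : 3 ≤ s) {α ζ : ℂ} (hζ : ζ ^ (s - 2) = 1)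
    (β β' : ℕ → ℂ) :
    (∀ j, j + 2 ≤ n → corr n s α β' j = ζ ^ (n - 2 - j) * corr n s α β j) ↔
      ∀ i, 1 ≤ i → i ≤ n - 1 → β' i = ζ ^ (n - 1 - i) * β i := by
  have key : ∀ j, j + 2 ≤ n → (corr n s α β' j = ζ ^ (n - 2 - j) * corr n s α β j ↔
      β' (j + 1) = ζ ^ (n - 1 - (j + 1)) * β (j + 1)) := by
    intro j hj
    rw [show n - 1 - (j + 1) = n - 2 - j by omega, corr, corr, if_pos hj, if_pos hj]
    by_cases h1 : j + 2 = n
    · rw [show n - 2 - j = 0 by omega, pow_zero, one_mul, one_mul]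
      simp
    · by_cases h2 : j + s = n
      · rw [show n - 2 - j = s - 2 by omega, hζ, one_mul, one_mul]
        simp
      · simp [h1, h2]
  constructor
  · intro h i h1 h2
    obtain ⟨j, rfl⟩ := Nat.exists_eq_add_of_le' h1
    exact (key j (by omega)).1 (h j (by omega))
  · exact fun h j hj => (key j hj).2 (h (j + 1) (by omega) (by omega))

/-- The isomorphism problem for normal forms of algebras `(12)_s(α, β)`. -/
theorem isomorphic_twelve_iff {n s J J' : ℕ} {α α' : ℂ} {β β' : ℕ → ℂ}
    (hc : IsNormal n s (corr n s α β) J) (hc' : IsNormal n s (corr n s α' β') J') :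
    Isomorphic (mu n) (ofSum n (twelve n s α β)) (mu n) (ofSum n (twelve n s α' β')) ↔
      α' = α ∧ ∃ ζ : ℂ, ζ ^ (s - 2) = 1 ∧
        ∀ i, 1 ≤ i → i ≤ n - 1 → β' i = ζ ^ (n - 1 - i) * β i := by
  have hs := hc.three_le
  have hsn := hc.le
  rw [ofSum_twelve hs, ofSum_twelve hs]
  constructor
  · intro h
    obtain ⟨rfl, -, -, -, ζ, hζ, hrel⟩ := hc.of_isomorphic hc' h
    exact ⟨rfl, ζ, hζ, (corr_root_iff hs hζ β β').1 hrel⟩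
  · rintro ⟨rfl, ζ, hζ, hrel⟩
    exact isomorphic_of_root hs hsn hc.last hc'.last hζ ((corr_root_iff hs hζ β β').2 hrel)

/-! ### Leading corrections and families of the listed algebras -/

/-- The full tuple of parameters of `A4`. -/
def betaA4 (s : ℕ) (β : ℕ → ℂ) : ℕ → ℂ := fun i => if s ≤ i then β i else 0

/-- The full tuple of parameters of `A5`. -/
def betaA5 (n s r : ℕ) (α : ℂ) (β : ℕ → ℂ) : ℕ → ℂ := fun i => if i = n - 1 then α
      else if s - r + 1 ≤ i ∧ i ≤ n - r then β i else 0

/-- The full tuple of parameters of `A6`. -/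
def betaA6 (n s : ℕ) (α : ℂ) (β : ℕ → ℂ) : ℕ → ℂ := fun i => if i = n - 1 then α
      else if 2 ≤ i ∧ i ≤ n - s + 1 then β i else 0

/-- The full tuple of parameters of `A7`. -/
noncomputable def betaA7 (n s : ℕ) (α : ℂ) (β : ℕ → ℂ) : ℕ → ℂ := fun i => if i = n - 1 then α
      else if i = n - s + 1 then (s : ℂ) / 2
      else if 1 ≤ i ∧ i ≤ n - s then β i else 0

theorem star_A4 (n s : ℕ) (α : ℂ) (β : ℕ → ℂ) :
    (Label.A4 s α β).star n = ofSum n (twelve n s α (betaA4 s β)) := rfl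

theorem star_A5 (n s r : ℕ) (α : ℂ) (β : ℕ → ℂ) :
    (Label.A5 s r α β).star n = ofSum n (twelve n s α (betaA5 n s r α β)) := rfl

theorem star_A6 (n s : ℕ) (α : ℂ) (β : ℕ → ℂ) :
    (Label.A6 s α β).star n = ofSum n (twelve n s α (betaA6 n s α β)) := rfl

theorem star_A7 (n s : ℕ) (α : ℂ) (β : ℕ → ℂ) :
    (Label.A7 s α β).star n = ofSum n (twelve n s α (betaA7 n s α β)) := rfl

theorem isNormal_A4 {n s : ℕ} {α : ℂ} {β : ℕ → ℂ} (h : (Label.A4 s α β).Valid n) :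
    IsNormal n s (corr n s α (betaA4 s β)) (n - 2) := by
  obtain ⟨h1, h2, h3⟩ := h
  have hlead : corr n s α (betaA4 s β) (n - 2) = β (n - 1) - α := by
    rw [corr, betaA4, if_pos (by omega), show n - 2 + 1 = n - 1 by omega]
    rw [if_pos h2, if_pos (by omega), if_neg (by omega), sub_zero]
  refine ⟨h1, h2, by omega, by omega, fun j hj hjn => ?_, fun _ => ?_,
    Or.inr ⟨fun h => by omega, fun j hj => ?_⟩⟩
  · rw [corr, if_neg (by omega)]
  · rw [hlead]
    exact sub_ne_zero.2 h3
  · rw [corr, betaA4, if_pos (by omega)]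
    rw [if_neg (by omega), if_neg (by omega)]
    split_ifs <;> simp

theorem isNormal_A5 {n s r : ℕ} {α : ℂ} {β : ℕ → ℂ} (h : (Label.A5 s r α β).Valid n) :
    IsNormal n s (corr n s α (betaA5 n s r α β)) (n - r - 1) := by
  obtain ⟨h1, h2, h3, h4, h5⟩ := h
  refine ⟨by omega, h2, by omega, by omega, fun j hj hjn => ?_, fun _ => ?_,
    Or.inr ⟨fun h => by omega, fun j hj => ?_⟩⟩
  · rw [corr, betaA5]
    split_ifs <;> first | omega | simp
  · rw [corr, betaA5, if_pos (by omega), show n - r - 1 + 1 = n - r by omega]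
    rw [if_neg (by omega), if_pos (by omega), if_neg (by omega), if_neg (by omega)]
    simpa using h5
  · rw [corr, betaA5, if_pos (by omega)]
    rw [if_neg (by omega), if_neg (by omega), if_neg (by omega)]
    split_ifs <;> simp

theorem isNormal_A6 {n s : ℕ} {α : ℂ} {β : ℕ → ℂ} (h : (Label.A6 s α β).Valid n) :
    IsNormal n s (corr n s α (betaA6 n s α β)) (n - s) ∧
    2 * corr n s α (betaA6 n s α β) (n - s) ≠ (s : ℂ) - 2 := by
  obtain ⟨h1, h2, h3⟩ := h
  have hlead : 2 * corr n s α (betaA6 n s α β) (n - s) ≠ (s : ℂ) - 2 := by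
    rw [corr, betaA6, if_pos (by omega)]
    rw [if_neg (by omega), if_pos (by omega), if_neg (by omega), if_pos (by omega)]
    intro h0
    apply h3
    linear_combination h0 / 2
  refine ⟨⟨h1, h2, le_rfl, by omega, fun j hj hjn => ?_, fun h => by omega,
    Or.inr ⟨fun _ => hlead, fun j hj => ?_⟩⟩, hlead⟩
  · rw [corr, betaA6]
    split_ifs <;> first | omega | simp
  · rw [corr, betaA6, if_pos (by omega)]
    rw [if_neg (by omega), if_neg (by omega), if_neg (by omega), if_neg (by omega),
      if_neg (by omega)]
    simp

theorem isNormal_A7 {n s : ℕ} {α : ℂ} {β : ℕ → ℂ} (h : (Label.A7 s α β).Valid n) :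
    IsNormal n s (corr n s α (betaA7 n s α β)) (n - s) ∧
    2 * corr n s α (betaA7 n s α β) (n - s) = (s : ℂ) - 2 := by
  obtain ⟨h1, h2⟩ := h
  have hlead : 2 * corr n s α (betaA7 n s α β) (n - s) = (s : ℂ) - 2 := by
    rw [corr, betaA7, if_pos (by omega)]
    rw [if_neg (by omega), if_pos rfl, if_neg (by omega), if_pos (by omega)]
    ring
  refine ⟨⟨h1, h2, le_rfl, by omega, fun j hj hjn => ?_, fun h => by omega,
    Or.inl ⟨rfl, hlead⟩⟩, hlead⟩
  rw [corr, betaA7]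
  split_ifs <;> first | omega | simp

/-- The family of a product `stdProduct n (lead α 0 3) c` with leading correction `c_J`. -/
def familyZero (n J : ℕ) : Family := if J + 2 = n then .F2 else .F3 (n - 1 - J)

open Classical in
/-- The family of a normal form with leading correction `c_J`. -/
noncomputable def familyOne (n s J : ℕ) (x : ℂ) : Family :=
  if J = n - s then (if 2 * x = (s : ℂ) - 2 then .F7 s else .F6 s)
  else if J + 2 = n then .F4 s else .F5 s (n - 1 - J)

/-- The family is a function of the invariants: the type of g, then s, the leading index J and, for
J = n - s, whether 2 c_J = s - 2. Separating families thus reduces to the invariance of these data.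
-/
theorem star_cases {n : ℕ} (hn : 2 ≤ n) {L : Label} (h : L.Valid n) :
    (L.family = .F1 ∧ ∃ c : ℕ → ℂ, c (n - 1) = -1 ∧ L.star n = stdProduct n X c) ∨
    (3 ≤ n ∧ ∃ (α : ℂ) (c : ℕ → ℂ) (J : ℕ), L.star n = stdProduct n (lead α 0 3) c ∧
      J + 2 ≤ n ∧ c J ≠ 0 ∧ (∀ j, J < j → j < n → c j = 0) ∧ L.family = familyZero n J) ∨
    (∃ (α : ℂ) (s : ℕ) (c : ℕ → ℂ) (J : ℕ), L.star n = stdProduct n (lead α 1 s) c ∧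
      IsNormal n s c J ∧ L.family = familyOne n s J (c J)) := by
  cases L with
  | A1 β =>
    refine Or.inl ⟨rfl, _, ?_, star_A1 hn β⟩
    rw [corrA1, if_neg (by omega), if_neg (by omega)]
  | A2 α β =>
    obtain ⟨h1, h2⟩ := h
    refine Or.inr (Or.inl ⟨h1, α, _, n - 2, star_A2 n α β, by omega, ?_, fun j hj _ => ?_, ?_⟩)
    · simpa [Nat.sub_add_cancel hn, sub_eq_zero] using h2
    · rw [if_neg (by omega)]
    · rw [familyZero, if_pos (by omega)]
      rfl
  | A3 r α =>
    obtain ⟨h1, h2⟩ := h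
    refine Or.inr (Or.inl ⟨by omega, α, _, n - r - 1, star_A3 h1 α, by omega, ?_, fun j hj _ => ?_,
      ?_⟩)
    · rw [if_pos (by omega)]
      exact one_ne_zero
    · rw [if_neg (by omega)]
    · rw [familyZero, if_neg (by omega), show n - 1 - (n - r - 1) = r by omega]
      rfl
  | A4 s α β =>
    have h0 := isNormal_A4 h
    obtain ⟨h1, h2, -⟩ := h
    refine Or.inr (Or.inr ⟨α, s, _, n - 2, (star_A4 n s α β).trans (ofSum_twelve h1 _ _), h0, ?_⟩)
    rw [familyOne, if_neg (by omega), if_pos (by omega)]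
    rfl
  | A5 s r α β =>
    have h0 := isNormal_A5 h
    obtain ⟨h1, h2, h3, h4, -⟩ := h
    refine Or.inr (Or.inr ⟨α, s, _, n - r - 1, (star_A5 n s r α β).trans (ofSum_twelve (by omega) _ _), h0, ?_⟩)
    rw [familyOne, if_neg (by omega), if_neg (by omega), show n - 1 - (n - r - 1) = r by omega]
    rfl
  | A6 s α β =>
    have h0 := isNormal_A6 h
    obtain ⟨h1, h2, -⟩ := h
    refine Or.inr (Or.inr ⟨α, s, _, n - s, (star_A6 n s α β).trans (ofSum_twelve h1 _ _), h0.1, ?_⟩)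
    rw [familyOne, if_pos rfl, if_neg h0.2]
    rfl
  | A7 s α β =>
    have h0 := isNormal_A7 h
    obtain ⟨h1, h2⟩ := h
    refine Or.inr (Or.inr ⟨α, s, _, n - s, (star_A7 n s α β).trans (ofSum_twelve h1 _ _), h0.1, ?_⟩)
    rw [familyOne, if_pos rfl, if_pos h0.2]
    rfl

theorem is12Matching_star_of_two_le {n : ℕ} (hn : 2 ≤ n) {L : Label} (h : L.Valid n) :
    Is12Matching (mu n) (L.star n) := by
  rcases star_cases hn h with ⟨-, c, hc, hs⟩ | ⟨h3, α, c, J, hs, hJ, -, hc, -⟩ |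
    ⟨α, s, c, J, hs, hc, -⟩
  · rw [hs]
    exact is12Matching_stdProduct (by omega) (by simp) (by simp [hc])
  · rw [hs]
    refine is12Matching_stdProduct (by omega) (constantCoeff_lead _ _ (by omega)) ?_
    rw [coeff_one_lead _ _ (by omega), hc _ (by omega) (by omega), neg_zero]
  · rw [hs]
    have := hc.three_le
    refine is12Matching_stdProduct (by omega) (constantCoeff_lead _ _ (by omega)) ?_
    rw [coeff_one_lead _ _ (by omega), hc.last, neg_zero]

/-- Entries from the last nonzero one on are multiplied by powers of the constant term of u, so the
last nonzero index cannot move. -/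
theorem top_of_isomorphic_zero {n : ℕ} {α α' : ℂ} (hn : 3 ≤ n) {c c' : ℕ → ℂ}
    (h : Isomorphic (mu n) (stdProduct n (lead α 0 3) c) (mu n) (stdProduct n (lead α' 0 3) c'))
    {J J' : ℕ} (hJ : J < n) (hJ' : J' < n) (hcJ : c J ≠ 0) (hcJ' : c' J' ≠ 0)
    (hc : ∀ j, J < j → j < n → c j = 0) (hc' : ∀ j, J' < j → j < n → c' j = 0) : J = J' := by
  obtain ⟨-, u, hu, hrel⟩ := rel_of_isomorphic_zero hn h
  have htop : ∀ j, J' ≤ j → j < n →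
      constantCoeff u ^ (j + 2) * c' j = c j * constantCoeff u ^ n := by
    intro j hj hjn
    rw [← hrel j hjn, lam_X_pow_mul_pow hc' hj hjn]
  rcases lt_trichotomy J J' with hlt | heq | hgt
  · have := htop J' le_rfl hJ'
    rw [hc J' hlt hJ', zero_mul] at this
    exact absurd this (mul_ne_zero (pow_ne_zero _ hu) hcJ')
  · exact heq
  · have := htop J hgt.le hJ
    rw [hc' J hgt hJ, mul_zero] at this
    exact absurd this.symm (mul_ne_zero hcJ (pow_ne_zero _ hu))

theorem family_eq_of_isomorphic {n : ℕ} (hn : 2 ≤ n) {L L' : Label} (h : L.Valid n)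
    (h' : L'.Valid n) (hiso : Isomorphic (mu n) (L.star n) (mu n) (L'.star n)) :
    L.family = L'.family := by
  rcases star_cases hn h with ⟨hf, c, hc, hs⟩ | ⟨h3, α, c, J, hs, hJ, hcJ, hc, hf⟩ |
    ⟨α, s, c, J, hs, hc, hf⟩ <;>
  rcases star_cases hn h' with ⟨hf', c', hc', hs'⟩ | ⟨h3', α', c', J', hs', hJ', hcJ', hc', hf'⟩ |
    ⟨α', s', c', J', hs', hc', hf'⟩ <;> rw [hs, hs'] at hiso
  · rw [hf, hf']
  · exact absurd hiso (not_isomorphic_X_lead hn (by omega))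
  · exact absurd hiso (not_isomorphic_X_lead hn (by have := hc'.three_le; omega))
  · exact absurd hiso.symm (not_isomorphic_X_lead hn (by omega))
  · rw [hf, hf', top_of_isomorphic_zero h3 hiso (by omega) (by omega) hcJ hcJ' hc hc']
  · exact absurd hiso (not_isomorphic_zero_one hc'.three_le hc'.le)
  · exact absurd hiso.symm (not_isomorphic_X_lead hn (by have := hc.three_le; omega))
  · exact absurd hiso.symm (not_isomorphic_zero_one hc.three_le hc.le)
  · obtain ⟨-, rfl, rfl, hJ, -⟩ := hc.of_isomorphic hc' hiso
    rw [hf, hf', familyOne, familyOne]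
    split_ifs with h1 h2 h3 h4 <;> first | rfl | (rw [hJ h1] at *; contradiction)

theorem stdProduct_ext {n : ℕ} {g : ℂ⟦X⟧} {c c' : ℕ → ℂ} (h : ∀ j, j < n → c j = c' j) :
    stdProduct n g c = stdProduct n g c' := by
  refine stdProduct_congr (fun j hj => ?_) fun m hm => ?_
  · rw [std, if_pos (by omega), Nat.add_sub_cancel, h j hj]
  · rw [std, if_neg (by omega)]

/-! ### Isomorphisms inside a family -/

section SameFamily

theorem star_A1_one (β β' : ℕ → ℂ) : (Label.A1 β).star 1 = (Label.A1 β').star 1 := by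
  refine ext_e fun i j hi hj => ?_
  rw [Label.star, Label.star, ofSum_e hi hj, ofSum_e hi hj]
  obtain rfl : i = 0 := by omega
  obtain rfl : j = 0 := by omega
  rfl

theorem isomorphic_A1_iff {n : ℕ} (hn : 1 ≤ n) (β β' : ℕ → ℂ) :
    Isomorphic (mu n) ((Label.A1 β).star n) (mu n) ((Label.A1 β').star n) ↔
      ∀ i, 2 ≤ i → i ≤ n - 1 → β' i = β i := by
  rcases Nat.lt_or_ge n 2 with h | h
  · obtain rfl : n = 1 := by omega
    rw [star_A1_one β β']
    exact ⟨fun _ i h1 h2 => by omega, fun _ => Isomorphic.refl _ _⟩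
  · rw [star_A1 h, star_A1 h]
    constructor
    · intro hiso i h1 h2
      have := eq_of_isomorphic_X h hiso (i - 1) (by omega) (by omega)
      rw [corrA1, corrA1, if_neg (by omega), if_pos (by omega), if_neg (by omega),
        if_pos (by omega), Nat.sub_add_cancel (by omega)] at this
      exact this.symm
    · intro hβ
      have : corrA1 n β = corrA1 n β' := by
        ext j
        rw [corrA1, corrA1]
        split_ifs with h1 h2
        · rfl
        · exact (hβ _ (by omega) (by omega)).symm
        · rfl
      rw [this]
      exact Isomorphic.refl _ _

theorem isomorphic_A2_iff {n : ℕ} (hn : 3 ≤ n) (α β α' β' : ℂ) :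
    Isomorphic (mu n) ((Label.A2 α β).star n) (mu n) ((Label.A2 α' β').star n) ↔
      α' = α ∧ β' = β := by
  constructor
  · intro h
    rw [star_A2, star_A2] at h
    obtain ⟨rfl, u, hu, hrel⟩ := rel_of_isomorphic_zero hn h
    refine ⟨rfl, ?_⟩
    have := hrel (n - 2) (by omega)
    rw [lam_X_pow_mul_pow (J := n - 2) (fun j h1 h2 => if_neg (by omega)) le_rfl (by omega),
      if_pos (by omega), if_pos (by omega), Nat.sub_add_cancel (by omega), mul_comm] at this
    have := mul_right_cancel₀ (pow_ne_zero _ hu) this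
    linear_combination this
  · rintro ⟨rfl, rfl⟩
    exact Isomorphic.refl _ _

theorem isomorphic_A3_iff {n r : ℕ} (hr : 2 ≤ r) (hrn : r ≤ n - 1) (α α' : ℂ) :
    Isomorphic (mu n) ((Label.A3 r α).star n) (mu n) ((Label.A3 r α').star n) ↔ α' = α := by
  constructor
  · intro h
    rw [star_A3 hr, star_A3 hr] at h
    exact (rel_of_isomorphic_zero (by omega) h).1.symm
  · rintro rfl
    exact Isomorphic.refl _ _

theorem isomorphic_A4_iff {n s : ℕ} {α α' : ℂ} {β β' : ℕ → ℂ}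
    (h : (Label.A4 s α β).Valid n) (h' : (Label.A4 s α' β').Valid n) :
    Isomorphic (mu n) ((Label.A4 s α β).star n) (mu n) ((Label.A4 s α' β').star n) ↔
      α' = α ∧ Label.RootRelated n s s (n - 1) β β' := by
  rw [star_A4, star_A4, isomorphic_twelve_iff (isNormal_A4 h) (isNormal_A4 h')]
  obtain ⟨h1, h2, -⟩ := h
  refine and_congr_right fun hα => exists_congr fun ζ => and_congr_right fun hζ => ⟨?_, ?_⟩
  · intro H i hi1 hi2
    have := H i (by omega) hi2
    rwa [betaA4, betaA4, if_pos hi1, if_pos hi1] at this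
  · intro H i hi1 hi2
    rw [betaA4, betaA4]
    split_ifs with hi
    · exact H i hi hi2
    · rw [mul_zero]

theorem isomorphic_A5_iff {n s r : ℕ} {α α' : ℂ} {β β' : ℕ → ℂ}
    (h : (Label.A5 s r α β).Valid n) (h' : (Label.A5 s r α' β').Valid n) :
    Isomorphic (mu n) ((Label.A5 s r α β).star n) (mu n) ((Label.A5 s r α' β').star n) ↔
      α' = α ∧ Label.RootRelated n s (s - r + 1) (n - r) β β' := by
  rw [star_A5, star_A5, isomorphic_twelve_iff (isNormal_A5 h) (isNormal_A5 h')]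
  obtain ⟨h1, h2, h3, h4, -⟩ := h
  refine and_congr_right fun hα => exists_congr fun ζ => and_congr_right fun hζ => ⟨?_, ?_⟩
  · intro H i hi1 hi2
    have := H i (by omega) (by omega)
    rwa [betaA5, betaA5, if_neg (by omega), if_pos ⟨hi1, hi2⟩, if_neg (by omega),
      if_pos ⟨hi1, hi2⟩] at this
  · intro H i hi1 hi2
    rw [betaA5, betaA5]
    split_ifs with hi hi'
    · rw [hi, Nat.sub_self, pow_zero, one_mul, hα]
    · exact H i hi'.1 hi'.2
    · rw [mul_zero]

theorem isomorphic_A6_iff {n s : ℕ} {α α' : ℂ} {β β' : ℕ → ℂ}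
    (h : (Label.A6 s α β).Valid n) (h' : (Label.A6 s α' β').Valid n) :
    Isomorphic (mu n) ((Label.A6 s α β).star n) (mu n) ((Label.A6 s α' β').star n) ↔
      α' = α ∧ Label.RootRelated n s 2 (n - s + 1) β β' := by
  rw [star_A6, star_A6, isomorphic_twelve_iff (isNormal_A6 h).1 (isNormal_A6 h').1]
  obtain ⟨h1, h2, -⟩ := h
  refine and_congr_right fun hα => exists_congr fun ζ => and_congr_right fun hζ => ⟨?_, ?_⟩
  · intro H i hi1 hi2
    have := H i (by omega) (by omega)
    rwa [betaA6, betaA6, if_neg (by omega), if_pos ⟨hi1, hi2⟩, if_neg (by omega),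
      if_pos ⟨hi1, hi2⟩] at this
  · intro H i hi1 hi2
    rw [betaA6, betaA6]
    split_ifs with hi hi'
    · rw [hi, Nat.sub_self, pow_zero, one_mul, hα]
    · exact H i hi'.1 hi'.2
    · rw [mul_zero]

theorem isomorphic_A7_iff {n s : ℕ} {α α' : ℂ} {β β' : ℕ → ℂ}
    (h : (Label.A7 s α β).Valid n) (h' : (Label.A7 s α' β').Valid n) :
    Isomorphic (mu n) ((Label.A7 s α β).star n) (mu n) ((Label.A7 s α' β').star n) ↔
      α' = α ∧ Label.RootRelated n s 1 (n - s) β β' := by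
  rw [star_A7, star_A7, isomorphic_twelve_iff (isNormal_A7 h).1 (isNormal_A7 h').1]
  obtain ⟨h1, h2⟩ := h
  refine and_congr_right fun hα => exists_congr fun ζ => and_congr_right fun hζ => ⟨?_, ?_⟩
  · intro H i hi1 hi2
    have := H i (by omega) (by omega)
    rwa [betaA7, betaA7, if_neg (by omega), if_neg (by omega), if_pos ⟨hi1, hi2⟩,
      if_neg (by omega), if_neg (by omega), if_pos ⟨hi1, hi2⟩] at this
  · intro H i hi1 hi2
    rw [betaA7, betaA7]
    split_ifs with hi hi' hi''
    · rw [hi, Nat.sub_self, pow_zero, one_mul, hα]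
    · rw [show n - 1 - i = s - 2 by omega, hζ, one_mul]
    · exact H i hi''.1 hi''.2
    · rw [mul_zero]

theorem isomorphic_iff_sameParameters {n : ℕ} (hn : 1 ≤ n) {L L' : Label} (h : L.Valid n)
    (h' : L'.Valid n) (hf : L.family = L'.family) :
    Isomorphic (mu n) (L.star n) (mu n) (L'.star n) ↔ L.SameParameters n L' := by
  cases L <;> cases L' <;> simp only [Label.family, reduceCtorEq, Family.F3.injEq,
    Family.F4.injEq, Family.F5.injEq, Family.F6.injEq, Family.F7.injEq] at hf
  · exact isomorphic_A1_iff hn _ _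
  · exact isomorphic_A2_iff h.1 _ _ _ _
  · subst hf
    exact (isomorphic_A3_iff h.1 h.2 _ _).trans (by simp [Label.SameParameters])
  · subst hf
    exact (isomorphic_A4_iff h h').trans (by simp [Label.SameParameters])
  · obtain ⟨rfl, rfl⟩ := hf
    exact (isomorphic_A5_iff h h').trans (by simp [Label.SameParameters])
  · subst hf
    exact (isomorphic_A6_iff h h').trans (by simp [Label.SameParameters])
  · subst hf
    exact (isomorphic_A7_iff h h').trans (by simp [Label.SameParameters])

end SameFamily

/-! ### The listed algebras are matching, including dimension one -/

theorem mu_one (a b : Fin 1 → ℂ) : mu 1 a b = 0 := by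
  obtain ⟨x, rfl⟩ := exists_toV 1 a
  obtain ⟨y, rfl⟩ := exists_toV 1 b
  rw [mu_toV]
  exact toV_eq_zero (dvd_mul_right _ _)

theorem is12Matching_star {n : ℕ} (hn : 1 ≤ n) {L : Label} (h : L.Valid n) :
    Is12Matching (mu n) (L.star n) := by
  rcases Nat.lt_or_ge n 2 with h2 | h2
  · obtain rfl : n = 1 := by omega
    refine ⟨mu_assoc 1, fun a b c => ?_, fun a b c => by simp [mu_one],
      fun a b c => by simp [mu_one]⟩
    -- Every bilinear product on a one-dimensional space is associative.
    have hsmul : ∀ v : Fin 1 → ℂ, v = v 0 • e 1 1 := by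
      intro v
      ext i
      fin_cases i
      simp [e]
    rw [hsmul a, hsmul b, hsmul c]
    generalize hx : L.star 1 (e 1 1) (e 1 1) = x
    simp only [map_smul, LinearMap.smul_apply, hx]
    rw [hsmul x]
    simp only [map_smul, LinearMap.smul_apply, hx, smul_smul]
  · exact is12Matching_star_of_two_le h2 h

/-! ### Reduction to the list -/

theorem Isomorphic.isIdMatching {V W : Type*} [AddCommGroup V] [Module ℂ V] [AddCommGroup W]
    [Module ℂ W] {dot star : Product V} {dot' star' : Product W}
    (h : Isomorphic dot star dot' star') (h' : IsIdMatching dot' star') :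
    IsIdMatching dot star := by
  obtain ⟨φ, h1, h2⟩ := h
  refine ⟨?_, ?_, ?_, ?_⟩ <;> intro a b c <;> apply φ.injective <;> simp only [h1, h2]
  · exact h'.dot_assoc _ _ _
  · exact h'.star_assoc _ _ _
  · exact h'.dot_star _ _ _
  · exact h'.star_dot _ _ _

/-- Transport of a product in standard form along `e_1 ↦ X u`. -/
theorem exists_isomorphic_stdProduct {n : ℕ} (hn : 1 ≤ n) {g g' u : ℂ⟦X⟧}
    (hg : constantCoeff g = 0) (hg' : constantCoeff g' = 0) (hu : constantCoeff u ≠ 0)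
    {c : ℕ → ℂ} (hc : c (n - 1) = -coeff 1 g) {r : ℂ}
    (H : ∀ φ : (Fin n → ℂ) ≃ₗ[ℂ] (Fin n → ℂ), (∀ k, φ (toV n (X ^ k)) = toV n ((X * u) ^ k)) →
      φ (toV n g' + r • e n n) = toV n (u ^ 2 * g) + lam n c (u ^ 2) • e n n) :
    ∃ c' : ℕ → ℂ, c' 0 = r ∧ c' (n - 1) = -coeff 1 g' ∧
      Isomorphic (mu n) (stdProduct n g c) (mu n) (stdProduct n g' c') := by
  obtain ⟨φ, hφ, hmu⟩ := exists_aut n hu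
  -- Only the square of e_1 in the pulled-back product has to be known; the structure theorem then
  -- supplies all corrections.
  obtain ⟨star', h12, hs⟩ := (is12Matching_stdProduct hn hg hc).pullback φ hmu
  have h1 : star' (e n 1) (e n 1) = toV n g' + r • e n n := by
    apply φ.injective
    rw [hs, H φ hφ, ← toV_X_pow, hφ, pow_one, stdProduct_toV hg, ← pow_two]
  obtain ⟨c', hc0, rfl⟩ := eq_stdProduct_of_is12Matching hn h12 hg' h1
  refine ⟨c', hc0, ?_, Isomorphic.symm ⟨φ, hmu, hs⟩⟩
  have hXn : ∀ y : ℂ⟦X⟧, y ^ n = y * y ^ (n - 1) := fun y => by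
    rw [← pow_succ', Nat.sub_add_cancel hn]
  -- The vanishing of e_1 ⋆ e_n is carried back along φ and gives the value of c' (n - 1).
  have h2 := hs (toV n (X ^ 1)) (toV n (X ^ n))
  rw [hφ, hφ, hXn (X * u), hXn X, pow_succ', pow_succ', mul_assoc X u, mul_assoc X u,
    stdProduct_toV hg, stdProduct_toV hg',
    show u * (X * u) ^ 0 * (u * (X * u) ^ (n - 1)) = X ^ (n - 1) * (u * u * u ^ (n - 1)) by ring,
    stdProduct_top hn hg hc, pow_zero, one_mul, lam_X_pow _ (by omega)] at h2
  have h3 := φ.injective (h2.trans (map_zero φ).symm)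
  obtain ⟨w, rfl⟩ := X_dvd_iff.2 hg'
  rw [← mul_assoc, ← pow_succ, Nat.sub_add_cancel hn, toV_X_pow_mul, ← add_smul] at h3
  have h4 := smul_e_injective hn (h3.trans (zero_smul ℂ (e n n)).symm)
  rw [show coeff 1 (X * w) = coeff (0 + 1) (X * w) by rfl, coeff_succ_X_mul,
    coeff_zero_eq_constantCoeff_apply]
  linear_combination h4

theorem exists_A1 {n : ℕ} (hn : 2 ≤ n) {g : ℂ⟦X⟧} (hg : constantCoeff g = 0)
    (hg1 : coeff 1 g ≠ 0) {c : ℕ → ℂ} (hc : c (n - 1) = -coeff 1 g) :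
    ∃ β, Isomorphic (mu n) (stdProduct n g c) (mu n) ((Label.A1 β).star n) := by
  obtain ⟨w, hw⟩ := X_dvd_iff.2 hg
  have hw0 : constantCoeff w ≠ 0 := by
    rwa [hw, show coeff 1 (X * w) = coeff (0 + 1) (X * w) by rfl, coeff_succ_X_mul,
      coeff_zero_eq_constantCoeff_apply] at hg1
  have hwi : w * w⁻¹ = 1 := PowerSeries.mul_inv_cancel w hw0
  -- The unit must solve X u = u² g + `lam` (u²) e_n. Modulo e_n this is u w = 1; the term γ X^(n-1)
  -- adjusts the e_n-component and leaves the right side unchanged, since multiples of X^(n-1)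
  -- contribute nothing there.
  set γ := lam n c (w⁻¹ ^ 2)
  have hn1 : n - 1 ≠ 0 := by omega
  obtain ⟨c', hc0, hc1, hiso⟩ := exists_isomorphic_stdProduct (by omega) hg (g' := X) (by simp)
    (u := w⁻¹ + X ^ (n - 1) * C γ) (by simp [hw0, hn1]) hc (r := 0) (by
      intro φ hφ
      have h1 := stdProduct_top (by omega) hg hc (C γ * (2 * w⁻¹ + X ^ (n - 1) * C γ))
      rw [zero_smul, add_zero, ← pow_one X, hφ, pow_one, pow_one,
        show (w⁻¹ + X ^ (n - 1) * C γ) ^ 2 =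
          w⁻¹ ^ 2 + X ^ (n - 1) * (C γ * (2 * w⁻¹ + X ^ (n - 1) * C γ)) by ring, add_mul,
        map_add, map_add, add_smul, add_add_add_comm, h1, add_zero, mul_add, map_add]
      congr 1
      · rw [hw]
        congr 1
        linear_combination -X * w⁻¹ * hwi
      · rw [← mul_assoc, ← pow_succ', Nat.sub_add_cancel (by omega), toV_X_pow_mul,
          constantCoeff_C])
  refine ⟨fun i => c' (i - 1), ?_⟩
  rw [star_A1 hn]
  rwa [stdProduct_ext (c := c') (c' := corrA1 n fun i => c' (i - 1))] at hiso
  intro j hj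
  rw [corrA1]
  split_ifs with h1 h2
  · rw [h1, hc0]
  · rfl
  · rw [show j = n - 1 by omega, hc1]
    simp

theorem exists_leading {n : ℕ} {c : ℕ → ℂ} {P : ℕ → Prop} (h : ∃ j, j < n ∧ P j ∧ c j ≠ 0) :
    ∃ J, J < n ∧ P J ∧ c J ≠ 0 ∧ ∀ j, J < j → j < n → P j → c j = 0 := by
  classical
  have hne : ((Finset.range n).filter fun j => P j ∧ c j ≠ 0).Nonempty := by
    obtain ⟨j, h1, h2⟩ := h
    exact ⟨j, Finset.mem_filter.2 ⟨Finset.mem_range.2 h1, h2⟩⟩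
  have hmem := Finset.mem_filter.1 (Finset.max'_mem _ hne)
  refine ⟨_, Finset.mem_range.1 hmem.1, hmem.2.1, hmem.2.2, fun j h1 h2 h3 => ?_⟩
  by_contra h4
  exact absurd (Finset.le_max' _ j (Finset.mem_filter.2 ⟨Finset.mem_range.2 h2, h3, h4⟩))
    (not_le.2 h1)

theorem exists_A2_or_A3 {n : ℕ} (hn : 3 ≤ n) {α : ℂ} {c : ℕ → ℂ} (hc : c (n - 1) = 0)
    (hc0 : ∃ j, j < n ∧ c j ≠ 0) : ∃ L : Label, L.Valid n ∧
      Isomorphic (mu n) (stdProduct n (lead α 0 3) c) (mu n) (L.star n) := by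
  obtain ⟨J, hJ, -, hcJ, hz⟩ := exists_leading (n := n) (c := c) (P := fun _ => True)
    (by simpa using hc0)
  have hJ2 : J + 2 ≤ n := by
    by_contra h
    exact hcJ (by rwa [show J = n - 1 by omega])
  have hz' : ∀ j, J < j → j < n → c j = 0 := fun j h1 h2 => hz j h1 h2 trivial
  obtain ⟨u, hu, hlam⟩ : ∃ u : ℂ⟦X⟧, X ∣ u - 1 ∧
      ∀ j, j < J → lam n c (X ^ j * u ^ (j + 2)) = 0 := by
    rcases Nat.eq_zero_or_pos J with h0 | hpos
    · exact ⟨1, by simp, fun j hj => by omega⟩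
    -- Here u need only be 1 modulo X and there is no extra term: d = 1 and ε = 0, so every pivot is
    -- a nonzero multiple of c J.
    · obtain ⟨u, hu, h⟩ := exists_unit_lam_eq c (fun _ => 0) 0 hJ le_rfl hpos hz'
        (fun _ => mul_ne_zero two_ne_zero hcJ) (fun _ => hcJ)
      exact ⟨u, by simpa using hu, fun j hj => by simpa using h j (by omega)⟩
  have hu1 : constantCoeff u = 1 := by
    have := X_dvd_iff.1 hu
    simpa [sub_eq_zero] using this
  have hiso : Isomorphic (mu n) (stdProduct n (lead α 0 3) c) (mu n)
      (stdProduct n (lead α 0 3) fun j => if j = J then c J else 0) := by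
    refine (isomorphic_zero (u := u) (by simp [hu1]) fun j hj => ?_).symm
    rw [hu1, one_pow, mul_one]
    rcases Nat.lt_or_ge j J with h | h
    · rw [hlam j h, if_neg h.ne]
    · rw [lam_X_pow_mul_pow hz' h hj, hu1, one_pow, one_mul]
      split_ifs with h1
      · rw [h1]
      · exact hz' j (by omega) hj
  rcases Nat.eq_or_lt_of_le hJ2 with h | h
  · refine ⟨.A2 α (α + c J), ⟨hn, by simpa using hcJ⟩, ?_⟩
    rw [star_A2]
    refine hiso.trans ?_
    rw [stdProduct_ext (n := n) (g := lead α 0 3)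
      (c := fun j => if j + 2 = n then α + c J - α else 0)
      (c' := fun j => if j = J then c J else 0)]
    · exact Isomorphic.refl _ _
    · intro j _
      simp only [show j + 2 = n ↔ j = J by omega, add_sub_cancel_left]
  -- Scaling e_1 by t compares t^(J+2) c_J with t^n, so c_J becomes 1. For J = n - 2 the two powers
  -- agree and c_J stays as the parameter of A2.
  · obtain ⟨t, ht⟩ := IsAlgClosed.exists_pow_nat_eq (c J) (by omega : 0 < n - J - 2)
    have ht0 : t ≠ 0 := by
      rintro rfl
      rw [zero_pow (by omega)] at ht
      exact hcJ ht.symm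
    refine ⟨.A3 (n - 1 - J) α, ⟨by omega, by omega⟩, hiso.trans ?_⟩
    rw [star_A3 (by omega)]
    refine (isomorphic_zero (u := C t) (by simpa using ht0) fun j hj => ?_).symm
    rw [← map_pow, mul_comm, ← smul_eq_C_mul, map_smul, lam_X_pow _ hj, constantCoeff_C]
    by_cases hjJ : j = J
    · rw [if_pos hjJ, if_pos (by omega), ← ht, smul_eq_mul, ← pow_add, one_mul]
      congr 1
      omega
    · rw [if_neg hjJ, if_neg (by omega), smul_zero, zero_mul]

theorem exists_isNormal {n s : ℕ} (hs : 3 ≤ s) (hsn : s ≤ n - 1) (α : ℂ) {c : ℕ → ℂ}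
    (hc : c (n - 1) = 0) : ∃ (c' : ℕ → ℂ) (J : ℕ), IsNormal n s c' J ∧
      Isomorphic (mu n) (stdProduct n (lead α 1 s) c) (mu n) (stdProduct n (lead α 1 s) c') := by
  have main : ∀ J, n - s ≤ J → J + 2 ≤ n → (∀ j, J < j → j < n → c j = 0) →
      (n - s < J → c J ≠ 0) → (J = n - s → 2 * c J ≠ (s : ℂ) - 2) →
      ∃ (c' : ℕ → ℂ) (J : ℕ), IsNormal n s c' J ∧
        Isomorphic (mu n) (stdProduct n (lead α 1 s) c) (mu n) (stdProduct n (lead α 1 s) c') := by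
    intro J h1 h2 h3 h4 h5
    -- The target is -1 at j = n - s because a parameter equal to 0 there corresponds to the
    -- correction -1.
    obtain ⟨u, hu, hlam⟩ := exists_unit_lam_eq c (fun j => if j + s = n then -1 else 0)
      ((s : ℂ) - 2) (by omega) (by omega) h1 h3 h5 h4
    have hu1 : constantCoeff u = 1 := by
      have := X_pow_dvd_iff.1 hu 0 (by omega)
      simpa [sub_eq_zero] using this
    set c' : ℕ → ℂ := fun j => lam n c (X ^ j * u ^ (j + 2)) -
      if j = 0 then ((s : ℂ) - 2) * coeff (n - s) u else 0 with hc'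
    have htop : ∀ j, J ≤ j → j < n → c' j = c j := by
      intro j hj hjn
      rw [hc']
      simp only
      rw [lam_X_pow_mul_pow h3 hj hjn, hu1, one_pow, one_mul, if_neg (by omega), sub_zero]
    refine ⟨c', J, ⟨hs, hsn, h1, h2, fun j hj hjn => ?_, ?_, Or.inr ⟨?_, fun j hj => ?_⟩⟩,
      (isomorphic_one hs hsn (ζ := 1) ?_ (one_pow _) hu fun j hj => ?_).symm⟩
    · rw [htop j hj.le hjn, h3 j hj hjn]
    · rw [htop J le_rfl (by omega)]
      exact h4
    · rw [htop J le_rfl (by omega)]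
      exact h5
    · rw [hc']
      simp only
      rw [hlam j hj, add_sub_cancel_right]
    · rw [htop _ (by omega) (by omega), hc]
    · rw [hc', one_pow, one_mul, sub_add_cancel]
  by_cases hex : ∃ j, j < n ∧ n - s < j ∧ c j ≠ 0
  · obtain ⟨J, hJ, hJs, hcJ, hz⟩ := exists_leading hex
    refine main J hJs.le ?_ (fun j h1 h2 => hz j h1 h2 (by omega)) (fun _ => hcJ)
      fun h => by omega
    by_contra h
    exact hcJ (by rwa [show J = n - 1 by omega])
  · have hz : ∀ j, n - s < j → j < n → c j = 0 := by
      intro j h1 h2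
      by_contra h
      exact hex ⟨j, h2, h1, h⟩
    -- With a zero pivot the corrections are already normal: no low entry is prescribed.
    by_cases hd : 2 * c (n - s) = (s : ℂ) - 2
    · exact ⟨c, n - s, ⟨hs, hsn, le_rfl, by omega, hz, fun h => by omega, Or.inl ⟨rfl, hd⟩⟩,
        Isomorphic.refl _ _⟩
    · exact main (n - s) le_rfl (by omega) hz (fun h => by omega) fun _ => hd

/-- The parameters `β` with corrections `c`. -/
noncomputable def betaOf (n s : ℕ) (α : ℂ) (c : ℕ → ℂ) (i : ℕ) : ℂ :=
  c (i - 1) + (if i + 1 = n then α else 0) + (if i + s = n + 1 then 1 else 0)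

theorem ofSum_twelve_eq {n s : ℕ} (hs : 3 ≤ s) {α : ℂ} {c β : ℕ → ℂ} (hc : c (n - 1) = 0)
    (h : ∀ i, 1 ≤ i → i ≤ n - 1 → β i = betaOf n s α c i) :
    ofSum n (twelve n s α β) = stdProduct n (lead α 1 s) c := by
  rw [ofSum_twelve hs]
  refine stdProduct_ext fun j hj => ?_
  rw [corr]
  split_ifs with h1 h2 h3 h3
  · omega
  · rw [h _ (by omega) (by omega), betaOf, if_pos (by omega), if_neg (by omega),
      Nat.add_sub_cancel]
    ring
  · rw [h _ (by omega) (by omega), betaOf, if_neg (by omega), if_pos (by omega),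
      Nat.add_sub_cancel]
    ring
  · rw [h _ (by omega) (by omega), betaOf, if_neg (by omega), if_neg (by omega),
      Nat.add_sub_cancel]
    ring
  · rw [show j = n - 1 by omega, hc]

theorem IsNormal.exists_label {n s J : ℕ} {c : ℕ → ℂ} (h : IsNormal n s c J) (α : ℂ) :
    ∃ L : Label, L.Valid n ∧ L.star n = stdProduct n (lead α 1 s) c := by
  obtain ⟨h1, h2, h3, h4, h5, h6, h7⟩ := id h
  have hlast := h.last
  have hβ : ∀ i, 1 ≤ i → i ≤ J - (n - s) + 1 → i + 1 ≠ n → (∀ j, j ≤ J - (n - s) →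
      c j = if j + s = n then -1 else 0) → betaOf n s α c i = 0 := by
    intro i hi1 hi2 hi3 hlow
    rw [betaOf, hlow _ (by omega), if_neg hi3]
    by_cases hi : i + s = n + 1
    · rw [if_pos hi, if_pos (by omega)]
      ring
    · rw [if_neg hi, if_neg (by omega)]
      ring
  have hα : J + 2 < n → betaOf n s α c (n - 1) = α := by
    intro hJ
    rw [betaOf, if_pos (by omega), if_neg (by omega), h5 _ (by omega) (by omega)]
    ring
  have hz : ∀ i, J + 1 < i → i < n - 1 → betaOf n s α c i = 0 := by
    intro i hi1 hi2
    rw [betaOf, if_neg (by omega), if_neg (by omega), h5 _ (by omega) (by omega)]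
    ring
  rcases Nat.eq_or_lt_of_le h3 with hJ | hJ
  · subst hJ
    have hd : betaOf n s α c (n - s + 1) = c (n - s) + 1 := by
      rw [betaOf, if_neg (by omega), if_pos (by omega), Nat.add_sub_cancel]
      ring
    by_cases hcs : 2 * c (n - s) = (s : ℂ) - 2
    · refine ⟨.A7 s α (betaOf n s α c), ⟨h1, h2⟩, ?_⟩
      rw [star_A7]
      refine ofSum_twelve_eq h1 hlast fun i hi1 hi2 => ?_
      rw [betaA7]
      split_ifs with ha hb hc
      · rw [ha, hα (by omega)]
      · rw [hb, hd]
        linear_combination -hcs / 2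
      · rfl
      · rw [hz i (by omega) (by omega)]
    · have hlow := (h7.resolve_left fun h => hcs h.2).2
      refine ⟨.A6 s α (betaOf n s α c), ⟨h1, h2, ?_⟩, ?_⟩
      · rw [hd]
        intro h0
        apply hcs
        linear_combination 2 * h0
      · rw [star_A6]
        refine ofSum_twelve_eq h1 hlast fun i hi1 hi2 => ?_
        rw [betaA6]
        split_ifs with ha hb
        · rw [ha, hα (by omega)]
        · rfl
        · rcases Nat.lt_or_ge i 2 with hi | hi
          · rw [hβ i hi1 (by omega) (by omega) hlow]
          · rw [hz i (by omega) (by omega)]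
  · have hlow := (h7.resolve_left fun h => by omega).2
    rcases Nat.eq_or_lt_of_le h4 with hJn | hJn
    · refine ⟨.A4 s α (betaOf n s α c), ⟨h1, h2, ?_⟩, ?_⟩
      · rw [betaOf, if_pos (by omega), if_neg (by omega), show n - 1 - 1 = J by omega]
        simpa using h6 hJ
      · rw [star_A4]
        refine ofSum_twelve_eq h1 hlast fun i hi1 hi2 => ?_
        rw [betaA4]
        split_ifs with ha
        · rfl
        · rw [hβ i hi1 (by omega) (by omega) hlow]
    · refine ⟨.A5 s (n - 1 - J) α (betaOf n s α c), ⟨by omega, h2, by omega, by omega, ?_⟩, ?_⟩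
      · rw [betaOf, if_neg (by omega), if_neg (by omega), show n - (n - 1 - J) - 1 = J by omega]
        simpa using h6 hJ
      · rw [star_A5]
        refine ofSum_twelve_eq h1 hlast fun i hi1 hi2 => ?_
        rw [betaA5]
        split_ifs with ha hb
        · rw [ha, hα hJn]
        · rfl
        · rcases Nat.lt_or_ge (J + 1) i with hi | hi
          · rw [hz i hi (by omega)]
          · rw [hβ i hi1 (by omega) (by omega) hlow]

theorem exists_label_of_lead {n : ℕ} (hn : 3 ≤ n) {g : ℂ⟦X⟧} (hg : X ^ 2 ∣ g) {c : ℕ → ℂ}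
    (hc : c (n - 1) = 0) : IsIdMatching (mu n) (stdProduct n g c) ∨
      ∃ L : Label, L.Valid n ∧ Isomorphic (mu n) (stdProduct n g c) (mu n) (L.star n) := by
  have hg0 : constantCoeff g = 0 := by simpa using X_pow_dvd_iff.1 hg 0 (by omega)
  have hg1 : coeff 1 g = 0 := X_pow_dvd_iff.1 hg 1 (by omega)
  have hn1 : 1 ≤ n := by omega
  have hcg : c (n - 1) = -coeff 1 g := by rw [hc, hg1, neg_zero]
  classical
  -- The bound k < n is deliberate: a coefficient at X^n is a multiple of e_n and belongs to the
  -- corrections.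
  by_cases hex : ∃ k, 3 ≤ k ∧ k < n ∧ coeff k g ≠ 0
  · right
    obtain ⟨h1, h2, h3⟩ := Nat.find_spec hex
    set s := Nat.find hex
    have hmin : ∀ k, 3 ≤ k → k < s → coeff k g = 0 := by
      intro k hk hks
      by_contra h
      exact Nat.find_min hex hks ⟨hk, by omega, h⟩
    obtain ⟨v, hv⟩ : X ^ s ∣ g - C (coeff 2 g) * X ^ 2 := by
      rw [X_pow_dvd_iff]
      intro m hm
      rw [map_sub, coeff_C_mul, coeff_X_pow]
      by_cases hm2 : m = 2
      · rw [hm2, if_pos rfl, mul_one, sub_self]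
      · rw [if_neg hm2, mul_zero, sub_zero]
        rcases Nat.lt_or_ge m 2 with h | h
        · exact X_pow_dvd_iff.1 hg m h
        · exact hmin m (by omega) hm
    have hg' : g = C (coeff 2 g) * X ^ 2 + X ^ s * v := by rw [← hv]; ring
    have hv0 : constantCoeff v ≠ 0 := by
      have := congrArg (coeff s) hv
      rw [map_sub, coeff_C_mul, coeff_X_pow, if_neg (by omega), mul_zero, sub_zero,
        show coeff s (X ^ s * v) = coeff (0 + s) (X ^ s * v) by rw [zero_add], coeff_X_pow_mul,
        coeff_zero_eq_constantCoeff_apply] at this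
      rwa [← this]
    -- Matching (X u)^s with u² X^s v requires u^(s-2) = v; an approximate root suffices modulo
    -- X^(n+1).
    obtain ⟨u, hu, w, hw⟩ := exists_pow_sub_dvd (k := s - 2) (by omega) hv0 n
    obtain ⟨c', -, hc', hiso⟩ := exists_isomorphic_stdProduct hn1 hg0
      (g' := lead (coeff 2 g) 1 s) (constantCoeff_lead _ _ (by omega)) hu
      hcg (r := lam n c (u ^ 2) / constantCoeff u ^ n) (by
        intro φ hφ
        have hlead := map_toV_lead hφ 0 (coeff 2 g) 1 s
        rw [pow_zero, one_mul, zero_add, zero_add] at hlead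
        have hen : φ (e n n) = constantCoeff u ^ n • e n n := by
          rw [← toV_X_pow, hφ, mul_pow, toV_X_pow_mul, map_pow, toV_X_pow]
        rw [map_add, hlead, map_smul, hen, smul_smul, div_mul_cancel₀ _ (pow_ne_zero _ hu)]
        congr 1
        apply toV_eq_of_dvd
        obtain ⟨k, hk⟩ := Nat.exists_eq_add_of_le' (by omega : 2 ≤ s)
        refine ⟨X ^ (k + 1) * u ^ 2 * w, ?_⟩
        rw [hk, Nat.add_sub_cancel] at hw
        rw [hg', map_add, coeff_C_mul, coeff_X_pow, if_pos rfl, mul_one, coeff_X_pow_mul',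
          if_neg (by omega), add_zero, hk, map_one]
        linear_combination X ^ (k + 2) * u ^ 2 * hw)
    rw [coeff_one_lead _ _ (by omega), neg_zero] at hc'
    obtain ⟨c'', J, hJ, hiso'⟩ := exists_isNormal h1 (by omega) (coeff 2 g) hc'
    obtain ⟨L, hL, hLs⟩ := hJ.exists_label (coeff 2 g)
    exact ⟨L, hL, by rw [hLs]; exact hiso.trans hiso'⟩
  -- Here g is α X² up to X^n, so u = 1 suffices and the coefficient at X^n moves into the
  -- correction c' 0.
  · obtain ⟨c', -, hc', hiso⟩ := exists_isomorphic_stdProduct hn1 hg0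
      (g' := lead (coeff 2 g) 0 3) (constantCoeff_lead _ _ (by omega)) (u := 1) (by simp)
      hcg (r := coeff n g + lam n c 1) (by
        intro φ hφ
        have hid : ∀ k, φ (toV n (X ^ k)) = toV n (X ^ k) := by simpa using hφ
        have hlead := map_toV_lead hφ 0 (coeff 2 g) 0 3
        rw [pow_zero, one_mul, zero_add, mul_one, map_zero, zero_mul, add_zero] at hlead
        rw [map_add, hlead, map_smul, ← toV_X_pow, hid, one_pow, one_mul, add_smul, ← add_assoc,
          ← map_smul, ← map_add]
        congr 1
        apply toV_eq_of_dvd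
        rw [X_pow_dvd_iff]
        intro m hm
        rw [map_sub, map_add, coeff_C_mul, coeff_X_pow, map_smul, coeff_X_pow, smul_eq_mul]
        rcases Nat.lt_or_ge m 2 with h | h
        · rw [if_neg (by omega), if_neg (by omega), X_pow_dvd_iff.1 hg m h]
          ring
        · rcases Nat.eq_or_lt_of_le h with h' | h'
          · rw [← h', if_pos rfl, if_neg (by omega)]
            ring
          · rw [if_neg (by omega)]
            split_ifs with h''
            · rw [h'']
              ring
            · have : coeff m g = 0 := by
                by_contra hne
                exact hex ⟨m, by omega, by omega, hne⟩
              rw [this]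
              ring)
    rw [coeff_one_lead _ _ (by omega), neg_zero] at hc'
    by_cases hz : ∃ j, j < n ∧ c' j ≠ 0
    · obtain ⟨L, hL, hiso'⟩ := exists_A2_or_A3 hn (α := coeff 2 g) hc' hz
      exact Or.inr ⟨L, hL, hiso.trans hiso'⟩
    · refine Or.inl (hiso.isIdMatching (isIdMatching_stdProduct
        (constantCoeff_lead _ _ (by omega)) fun j hj => ?_))
      by_contra h
      exact hz ⟨j, hj, h⟩

/-- In dimension two only c 0 can be nonzero, and c 0 e_2 is absorbed into g. -/
theorem isIdMatching_stdProduct_two {g : ℂ⟦X⟧} (hg : X ^ 2 ∣ g) {c : ℕ → ℂ} (hc : c 1 = 0) :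
    IsIdMatching (mu 2) (stdProduct 2 g c) := by
  have h : stdProduct 2 g c = stdProduct 2 (g + c 0 • X ^ 2) fun _ => 0 := by
    refine stdProduct_congr (fun j hj => ?_) fun m hm => ?_
    · rw [std, if_pos (by omega), Nat.add_sub_cancel, zero_smul, add_zero]
      rcases Nat.eq_zero_or_pos j with rfl | hj0
      · rw [pow_zero, one_mul, one_mul, map_add, map_smul, toV_X_pow]
      · obtain rfl : j = 1 := by omega
        rw [hc, zero_smul, add_zero, mul_add, map_add, mul_smul_comm, map_smul, ← pow_add,
          toV_eq_zero (y := X ^ (1 + 2)) (by simp [pow_succ]), smul_zero, add_zero]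
    · rw [std, if_neg (by omega)]
  rw [h]
  refine isIdMatching_stdProduct ?_ fun _ _ => rfl
  have : constantCoeff g = 0 := by simpa using X_pow_dvd_iff.1 hg 0 (by omega)
  simp [this]

/-- Every `(12)`-matching structure is `id`-matching or in the list. -/
theorem exists_label {n : ℕ} (hn : 1 ≤ n) {star : Product (Fin n → ℂ)}
    (h : Is12Matching (mu n) star) : IsIdMatching (mu n) star ∨
      ∃ L : Label, L.Valid n ∧ Isomorphic (mu n) star (mu n) (L.star n) := by
  rcases Nat.eq_or_lt_of_le hn with rfl | hn2
  · exact Or.inl ⟨mu_assoc 1, h.star_assoc, fun a b c => by simp [mu_one],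
      fun a b c => by simp [mu_one]⟩
  rcases isIdMatching_or_exists_stdProduct hn h with hid | ⟨g, c, hg, hc, rfl⟩
  · exact Or.inl hid
  by_cases hg1 : coeff 1 g = 0
  · have hg2 : X ^ 2 ∣ g := by
      rw [X_pow_dvd_iff]
      intro m hm
      interval_cases m
      · simpa using hg
      · exact hg1
    rw [hg1, neg_zero] at hc
    rcases Nat.eq_or_lt_of_le hn2 with rfl | hn3
    · exact Or.inl (isIdMatching_stdProduct_two hg2 hc)
    · exact exists_label_of_lead hn3 hg2 hc
  · obtain ⟨β, hβ⟩ := exists_A1 hn2 hg hg1 hc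
    exact Or.inr ⟨.A1 β, trivial, hβ⟩

end Matching

theorem mainTheorem5 (n : ℕ) (hn : 1 ≤ n) :
    -- every `(12)`-matching structure is `id`-matching or isomorphic to an algebra of the list
    (∀ star : Matching.Product (Fin n → ℂ), Matching.Is12Matching (Matching.mu n) star →
      Matching.IsIdMatching (Matching.mu n) star ∨
      ∃ L : Matching.Label, L.Valid n ∧
        Matching.Isomorphic (Matching.mu n) star (Matching.mu n) (L.star n)) ∧
    -- every algebra of the list is a `(12)`-matching structure
    (∀ L : Matching.Label, L.Valid n → Matching.Is12Matching (Matching.mu n) (L.star n)) ∧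
    -- algebras of different families are never isomorphic
    (∀ L L' : Matching.Label, L.Valid n → L'.Valid n → L.family ≠ L'.family →
      ¬ Matching.Isomorphic (Matching.mu n) (L.star n) (Matching.mu n) (L'.star n)) ∧
    -- the isomorphisms inside a family
    (∀ L L' : Matching.Label, L.Valid n → L'.Valid n → L.family = L'.family →
      (Matching.Isomorphic (Matching.mu n) (L.star n) (Matching.mu n) (L'.star n) ↔
        L.SameParameters n L')) := by
  refine ⟨fun star h => Matching.exists_label hn h, fun L h => Matching.is12Matching_star hn h,
    fun L L' h h' hf hiso => ?_,
    fun L L' h h' hf => Matching.isomorphic_iff_sameParameters hn h h' hf⟩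
  rcases Nat.eq_or_lt_of_le hn with rfl | hn2
  -- For n = 1 the parameter bounds leave only A1.
  · refine hf ?_
    cases L <;> cases L' <;> simp only [Matching.Label.Valid] at h h' <;> first | rfl | omega
  · exact hf (Matching.family_eq_of_isomorphic hn2 h h' hiso)
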